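/- Let $d\ge 1$. All functions are complex valued, derivatives are taken in the sense of distributions, and $u\in H^2(\mathbb{R}^d)$ is a solution of $\Delta u+Vu=0$ on $\mathbb{R}^d$ with $V$ measurable. (i) For all real $L, A$ there is a constant $c>0$, depending only on $d$, $L$ and $A$, such that for all such $u$, $V$ with $$\|V\|_\infty\le L,\qquad \int_{|x|<1}|u(x)|^2\,dx\ge 1,\qquad \int_{\mathbb{R}^d}\big(|u(x)|^2+|\nabla u(x)|^2\big)\,dx\le A^2,$$ and for every $R\ge 1$, $$\lambda(R):=\left(\int_{R-1<|x|<R}\big(|u(x)|^2+|\nabla u(x)|^2\big)\,dx\right)^{1/2}\ \ge\ c\,e^{-cR^{4/3}}.$$ (ii) There is a constant $\eta_0>0$, depending only on the dimension $d$, such that for every $L\ge 0$ and all such $u$, $V$ with $\|V\|_\infty\le L$ the following holds: if $$\int_{\mathbb{R}^d}e^{2\eta_0L^{2/3}|x|^{4/3}}|u(x)|^2\,dx<+\infty,$$ then $u\equiv 0$. (In particular, for $\|V\|_\infty\le 1$ the weight is $e^{2\eta_0|x|^{4/3}}$.) -/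

import Mathlib

open MeasureTheory
open scoped SchwartzMap LineDeriv Laplacian

/-- Euclidean space `ℝ^d`. -/
abbrev Rd (d : ℕ) : Type := EuclideanSpace ℝ (Fin d)

/-- The space `L²(ℝ^d; ℂ)` with respect to Lebesgue measure. -/
abbrev L2 (d : ℕ) : Type := Lp ℂ 2 (volume : Measure (Rd d))

/-- `u ∈ H²(ℝ^d)`: the tempered distribution given by `u` lies in the Sobolev space of order `2`
based on `L²`. -/
def MemH2 {d : ℕ} (u : L2 d) : Prop :=
  TemperedDistribution.MemSobolev 2 2 (u : 𝓢'(Rd d, ℂ))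

/-- `G = (∂₁ u, …, ∂_d u)` with all derivatives taken in the sense of distributions.
For `u ∈ H²(ℝ^d)` there is exactly one such `G`. -/
def IsWeakGradient {d : ℕ} (u : L2 d) (G : Fin d → L2 d) : Prop :=
  ∀ i : Fin d, (G i : 𝓢'(Rd d, ℂ)) = ∂_{EuclideanSpace.single i (1 : ℝ)} (u : 𝓢'(Rd d, ℂ))

/-- `Δ u + V u = 0` on `ℝ^d`, where the product `V u` is (represented by) the `L²` function `W`
and `Δ` is the distributional Laplacian. -/
def SolvesElliptic {d : ℕ} (V : Rd d → ℂ) (u : L2 d) : Prop :=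
  ∃ W : L2 d, (∀ᵐ x, W x = V x * u x) ∧ Δ (u : 𝓢'(Rd d, ℂ)) + (W : 𝓢'(Rd d, ℂ)) = 0

/-- `‖V‖_∞ ≤ L`. -/
def PotentialBound {d : ℕ} (V : Rd d → ℂ) (L : ℝ) : Prop :=
  AEStronglyMeasurable V volume ∧ ∀ᵐ x, ‖V x‖ ≤ L

/-- The density `|u|² + |∇u|²`, where `G` is the gradient of `u`. -/
noncomputable def energyDensity {d : ℕ} (u : L2 d) (G : Fin d → L2 d) (x : Rd d) : ℝ :=
  ‖u x‖ ^ 2 + ∑ i, ‖G i x‖ ^ 2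

/-- `λ(R)`, the `H¹` norm of `u` on the ring `R - 1 < |x| < R`. -/
noncomputable def ringNorm {d : ℕ} (u : L2 d) (G : Fin d → L2 d) (R : ℝ) : ℝ :=
  Real.sqrt (∫ x in {x : Rd d | R - 1 < ‖x‖ ∧ ‖x‖ < R}, energyDensity u G x)

/-! Both parts rest on a Carleman inequality with the weight `exp (τ a²)`, where `a = xᵢ + 2R` is a
translated coordinate. The exponent is smooth and convex in a single direction, and the conjugated
Laplacian splits into a symmetric and an antisymmetric part whose product integrates to something
positive (`integral_commutator`). This gives `8τ³ ∫ e^{τa²} a² f² ≤ ∫ e^{τa²} (Δf)²`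
(`carleman_quadratic`).

On `|x| < R` one has `R ≤ a ≤ 3R`. For `f = χu`, with `χ` cutting off between radii `r < R`, the
term `|Δu|² ≤ L²|u|²` is absorbed on the left once `τ³R² ≥ L²`. What remains is the commutator of
`Δ` with `χ`, which lives on the ring `r < |x| < R` and costs at most `e^{9τR²}`, while the weight
is at least `1` on the inner ball (`carleman_ball`). The weight has no singularity, so no inner
cutoff is needed. Equality `τ³R² = L²` means `τR² = L^{2/3} R^{4/3}`, the source of the exponent
`4/3` (`exists_scale`).

For (i) take `r = R - 1`: the unit mass lies in the inner ball and the ring, so the ring norm cannot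
be too small. For (ii) take `r = 3R/4` and trade the gradient on the ring for mass in `|x| > R/2` by
a Caccioppoli inequality. The mass of the inner ball is then bounded by the tail of the weighted
integral, which tends to `0`.

The inequalities are proved for smooth real functions and carried to complex `H²` functions by
density (`quadratic_nonneg_of_smooth`). -/

/-- The `i`-th partial derivative. -/
noncomputable def pderiv {d : ℕ} (i : Fin d) (f : Rd d → ℝ) : Rd d → ℝ :=
  fun x => fderiv ℝ f x (EuclideanSpace.single i 1)

/-- The sum of the second partial derivatives. -/
noncomputable def lap {d : ℕ} (f : Rd d → ℝ) : Rd d → ℝ :=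
  fun x => ∑ i, pderiv i (pderiv i f) x

/-- The squared length of the gradient. -/
noncomputable def gradSq {d : ℕ} (f : Rd d → ℝ) : Rd d → ℝ :=
  fun x => ∑ i, pderiv i f x ^ 2

/-- Smooth real functions on `ℝ^d`. -/
abbrev Smooth {d : ℕ} (f : Rd d → ℝ) : Prop := ContDiff ℝ (⊤ : ℕ∞) f

/-! ### Calculus of smooth real functions on `ℝ^d`. -/

section Calculus

variable {d : ℕ} {f g : Rd d → ℝ}

theorem Smooth.differentiable (hf : Smooth f) : Differentiable ℝ f :=
  ContDiff.differentiable hf (by simp)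

theorem smooth_pderiv (hf : Smooth f) (i : Fin d) : Smooth (pderiv i f) :=
  (hf.fderiv_right (m := (⊤ : ℕ∞)) (by norm_cast)).clm_apply contDiff_const

theorem smooth_lap (hf : Smooth f) : Smooth (lap f) :=
  ContDiff.sum fun i _ => smooth_pderiv (smooth_pderiv hf i) i

theorem smooth_gradSq (hf : Smooth f) : Smooth (gradSq f) :=
  ContDiff.sum fun i _ => (smooth_pderiv hf i).pow 2

theorem gradSq_nonneg (f : Rd d → ℝ) (x : Rd d) : 0 ≤ gradSq f x :=
  Finset.sum_nonneg fun _ _ => sq_nonneg _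

theorem pderiv_of_hasFDerivAt {f' : Rd d →L[ℝ] ℝ} {x : Rd d} (h : HasFDerivAt f f' x)
    (i : Fin d) : pderiv i f x = f' (EuclideanSpace.single i 1) := by
  rw [pderiv, h.fderiv]

theorem pderiv_add (hf : Smooth f) (hg : Smooth g) (i : Fin d) :
    pderiv i (fun x => f x + g x) = fun x => pderiv i f x + pderiv i g x := by
  ext x
  rw [pderiv_of_hasFDerivAt ((hf.differentiable x).hasFDerivAt.fun_add
    (hg.differentiable x).hasFDerivAt)]
  rfl

theorem pderiv_sub (hf : Smooth f) (hg : Smooth g) (i : Fin d) :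
    pderiv i (fun x => f x - g x) = fun x => pderiv i f x - pderiv i g x := by
  ext x
  rw [pderiv_of_hasFDerivAt ((hf.differentiable x).hasFDerivAt.fun_sub
    (hg.differentiable x).hasFDerivAt)]
  rfl

theorem pderiv_mul (hf : Smooth f) (hg : Smooth g) (i : Fin d) :
    pderiv i (fun x => f x * g x) = fun x => pderiv i f x * g x + f x * pderiv i g x := by
  ext x
  rw [pderiv_of_hasFDerivAt ((hf.differentiable x).hasFDerivAt.fun_mul
    (hg.differentiable x).hasFDerivAt)]
  simp [pderiv]
  ring

theorem pderiv_const_mul (c : ℝ) (hf : Smooth f) (i : Fin d) :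
    pderiv i (fun x => c * f x) = fun x => c * pderiv i f x := by
  ext x
  rw [pderiv_of_hasFDerivAt ((hf.differentiable x).hasFDerivAt.const_mul c)]
  simp [pderiv]

theorem pderiv_comp {h h' : ℝ → ℝ} (hh : ∀ t, HasDerivAt h (h' t) t) (hf : Smooth f)
    (i : Fin d) : pderiv i (fun x => h (f x)) = fun x => h' (f x) * pderiv i f x := by
  ext x
  have := (hh (f x)).comp_hasFDerivAt x (hf.differentiable x).hasFDerivAt
  rw [show (fun x => h (f x)) = h ∘ f from rfl, pderiv_of_hasFDerivAt this]
  simp [pderiv]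

theorem pderiv_sum {ι : Type*} (s : Finset ι) {F : ι → Rd d → ℝ} (hF : ∀ j, Smooth (F j))
    (i : Fin d) : pderiv i (fun x => ∑ j ∈ s, F j x) = fun x => ∑ j ∈ s, pderiv i (F j) x := by
  ext x
  rw [pderiv_of_hasFDerivAt (HasFDerivAt.fun_sum fun j _ => ((hF j).differentiable x).hasFDerivAt)]
  simp [pderiv]

theorem pderiv_comm (hf : Smooth f) (i j : Fin d) :
    pderiv i (pderiv j f) = pderiv j (pderiv i f) := by
  have key : ∀ (i j : Fin d) (x : Rd d), pderiv i (pderiv j f) x =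
      fderiv ℝ (fderiv ℝ f) x (EuclideanSpace.single i 1) (EuclideanSpace.single j 1) := by
    intro i j x
    have h1 : DifferentiableAt ℝ (fderiv ℝ f) x :=
      (hf.fderiv_right (m := (⊤ : ℕ∞)) (by norm_cast)).differentiable (by simp) x
    have h2 := h1.hasFDerivAt.clm_apply
      (hasFDerivAt_const (EuclideanSpace.single j (1 : ℝ)) x)
    rw [show pderiv j f = fun y => fderiv ℝ f y (EuclideanSpace.single j 1) from rfl,
      pderiv_of_hasFDerivAt h2]
    simp
  ext x
  rw [key, key]
  have : IsSymmSndFDerivAt ℝ f x :=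
    hf.contDiffAt.isSymmSndFDerivAt (by simp; exact WithTop.coe_le_coe.2 le_top)
  exact this _ _

theorem pderiv_eq_zero_of_eventuallyEq {x : Rd d} {c : ℝ} (h : f =ᶠ[nhds x] fun _ => c)
    (i : Fin d) : pderiv i f x = 0 := by
  rw [pderiv, h.fderiv_eq]
  simp

theorem hasCompactSupport_pderiv (hf : HasCompactSupport f) (i : Fin d) :
    HasCompactSupport (pderiv i f) :=
  HasCompactSupport.intro' (K := tsupport f) hf (isClosed_tsupport f) fun _ hx =>
    pderiv_eq_zero_of_eventuallyEq (notMem_tsupport_iff_eventuallyEq.1 hx) i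

theorem hasCompactSupport_lap (hf : HasCompactSupport f) : HasCompactSupport (lap f) :=
  HasCompactSupport.intro' (K := tsupport f) hf (isClosed_tsupport f) fun x hx => by
    refine Finset.sum_eq_zero fun i _ => pderiv_eq_zero_of_eventuallyEq (c := 0) ?_ i
    have := notMem_tsupport_iff_eventuallyEq.1 hx
    filter_upwards [this.eventuallyEq_nhds] with y hy
    exact pderiv_eq_zero_of_eventuallyEq hy i

theorem hasCompactSupport_sq (hf : HasCompactSupport f) :
    HasCompactSupport fun x => f x ^ 2 :=
  hf.comp_left (g := fun t : ℝ => t ^ 2) (by simp)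

theorem Smooth.integrable (hf : Smooth f) (hc : HasCompactSupport f) : Integrable f :=
  hf.continuous.integrable_of_hasCompactSupport hc

theorem integral_pderiv_eq_zero (hf : Smooth f) (hc : HasCompactSupport f) (i : Fin d) :
    ∫ x, pderiv i f x = 0 := by
  have h := integral_mul_fderiv_eq_neg_fderiv_mul_of_integrable (𝕜 := ℝ)
    (μ := (volume : Measure (Rd d)))
    (f := fun _ => (1 : ℝ)) (g := f) (v := EuclideanSpace.single i 1) (by simp)
    (by simpa [pderiv] using! (smooth_pderiv hf i).integrable (hasCompactSupport_pderiv hc i))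
    (by simpa using hf.integrable hc) (fun _ _ => by fun_prop) (fun x _ => hf.differentiable x)
  simpa [pderiv] using h

theorem lap_mul (hf : Smooth f) (hg : Smooth g) (x : Rd d) :
    lap (fun x => f x * g x) x =
      f x * lap g x + 2 * ∑ i, pderiv i f x * pderiv i g x + g x * lap f x := by
  simp only [lap, Finset.mul_sum, ← Finset.sum_add_distrib]
  refine Finset.sum_congr rfl fun i _ => ?_
  have hf' := smooth_pderiv hf i
  have hg' := smooth_pderiv hg i
  rw [pderiv_mul hf hg, pderiv_add (hf'.mul hg) (hf.mul hg'), pderiv_mul hf' hg, pderiv_mul hf hg']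
  ring

end Calculus

/-! ### Carleman inequality for compactly supported smooth functions. -/

section Carleman

variable {d : ℕ}

/-- The affine function `x ↦ x i + s`. -/
noncomputable def affineCoord (i : Fin d) (s : ℝ) : Rd d → ℝ := fun x => x i + s

theorem smooth_affineCoord (i : Fin d) (s : ℝ) : Smooth (affineCoord i s) := by
  exact (EuclideanSpace.proj (𝕜 := ℝ) i : Rd d →L[ℝ] ℝ).contDiff.add contDiff_const

theorem pderiv_affineCoord (i j : Fin d) (s : ℝ) :
    pderiv j (affineCoord i s) = fun _ => if i = j then 1 else 0 := by
  ext x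
  have h : HasFDerivAt (affineCoord i s) (EuclideanSpace.proj (𝕜 := ℝ) i : Rd d →L[ℝ] ℝ) x :=
    (EuclideanSpace.proj (𝕜 := ℝ) i : Rd d →L[ℝ] ℝ).hasFDerivAt.add_const s
  rw [pderiv_of_hasFDerivAt h]
  simp

/-- The positive commutator identity for `Δ + τ² a²` and `-τ (2 a ∂ᵢ + 1)` with `a = xᵢ + s`. -/
theorem integral_commutator (i : Fin d) (s τ : ℝ) {v : Rd d → ℝ} (hv : Smooth v)
    (hc : HasCompactSupport v) :
    ∫ x, (lap v x + τ ^ 2 * affineCoord i s x ^ 2 * v x) *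
        (-τ * (2 * affineCoord i s x * pderiv i v x + v x)) =
      ∫ x, (2 * τ * pderiv i v x ^ 2 + 2 * τ ^ 3 * affineCoord i s x ^ 2 * v x ^ 2) := by
  set a := affineCoord i s with ha
  have hsa : Smooth a := smooth_affineCoord i s
  have hda : ∀ j, pderiv j a = fun _ => if i = j then 1 else 0 := fun j => pderiv_affineCoord i j s
  have hD : ∀ j, Smooth (pderiv j v) := fun j => smooth_pderiv hv j
  -- `-τ m` is the antisymmetric part of the conjugated Laplacian applied to `v`.
  set m : Rd d → ℝ := fun x => 2 * (a x * pderiv i v x) + v x with hm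
  have hsm : Smooth m := (contDiff_const.mul (hsa.mul (hD i))).add hv
  have hdm : ∀ j x, pderiv j m x = 2 * ((if i = j then 1 else 0) * pderiv i v x +
      a x * pderiv i (pderiv j v) x) + pderiv j v x := by
    intro j x
    rw [hm, pderiv_add (contDiff_const.mul (hsa.mul (hD i))) hv,
      pderiv_const_mul 2 (hsa.mul (hD i)), pderiv_mul hsa (hD i), hda, pderiv_comm hv j i]
  set P : Fin d → Rd d → ℝ := fun j x => pderiv j v x * m x with hP
  set Q : Rd d → ℝ := fun x => a x * gradSq v x with hQ
  set S : Rd d → ℝ := fun x => (a x * (a x * a x)) * (v x * v x) with hS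
  have hsP : ∀ j, Smooth (P j) := fun j => (hD j).mul hsm
  have hsG : Smooth (gradSq v) := smooth_gradSq hv
  have hsQ : Smooth Q := hsa.mul hsG
  have hsS : Smooth S := (hsa.mul (hsa.mul hsa)).mul (hv.mul hv)
  have hcP : ∀ j, HasCompactSupport (P j) := fun j => (hasCompactSupport_pderiv hc j).mul_right
  have hcG : HasCompactSupport (gradSq v) :=
    HasCompactSupport.intro' (K := tsupport v) hc (isClosed_tsupport v) fun x hx =>
      Finset.sum_eq_zero fun j _ => by
        rw [pderiv_eq_zero_of_eventuallyEq (notMem_tsupport_iff_eventuallyEq.1 hx) j]; simp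
  have hcQ : HasCompactSupport Q := hcG.mul_left
  have hcS : HasCompactSupport S := (hc.mul_left (f := v)).mul_left
  have hdP : ∀ j x, pderiv j (P j) x = pderiv j (pderiv j v) x * m x +
      pderiv j v x * pderiv j m x := fun j x => by rw [hP, pderiv_mul (hD j) hsm]
  have hdQ : ∀ x, pderiv i Q x = gradSq v x +
      a x * ∑ j, 2 * pderiv j v x * pderiv i (pderiv j v) x := by
    intro x
    have : gradSq v = fun x => ∑ j, pderiv j v x * pderiv j v x := by
      ext x; simp [gradSq, sq]
    rw [hQ, pderiv_mul hsa hsG, hda]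
    simp only [if_true, one_mul]
    congr 2
    rw [this, pderiv_sum _ fun j => (hD j).mul (hD j)]
    refine Finset.sum_congr rfl fun j _ => ?_
    rw [pderiv_mul (hD j) (hD j)]
    ring
  have hdS : ∀ x, pderiv i S x = 3 * a x ^ 2 * v x ^ 2 + 2 * a x ^ 3 * v x * pderiv i v x := by
    intro x
    rw [hS, pderiv_mul (hsa.mul (hsa.mul hsa)) (hv.mul hv), pderiv_mul hsa (hsa.mul hsa),
      pderiv_mul hsa hsa, pderiv_mul hv hv, hda]
    simp only [if_true]
    ring
  -- Pointwise, the product is the positive density plus the divergence terms `-τ div(m∇v) + τ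
  -- ∂ᵢ(a|∇v|²) - τ³ ∂ᵢ(a³v²)`, which integrate to zero.
  have hpt : ∀ x, (lap v x + τ ^ 2 * a x ^ 2 * v x) * (-τ * (2 * a x * pderiv i v x + v x)) =
      (2 * τ * pderiv i v x ^ 2 + 2 * τ ^ 3 * a x ^ 2 * v x ^ 2) +
      ((-τ * ∑ j, pderiv j (P j) x + τ * pderiv i Q x) - τ ^ 3 * pderiv i S x) := by
    intro x
    have h1 : ∑ j, pderiv j (P j) x = lap v x * m x + (2 * pderiv i v x ^ 2 + pderiv i Q x) := by
      have h2 : ∑ j, pderiv j v x * pderiv j m x = 2 * pderiv i v x ^ 2 + pderiv i Q x := by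
        have : ∀ j, pderiv j v x * pderiv j m x =
            (if i = j then 2 * pderiv i v x * pderiv j v x else 0) +
            (pderiv j v x ^ 2 + a x * (2 * pderiv j v x * pderiv i (pderiv j v) x)) := by
          intro j
          rw [hdm]
          split_ifs <;> ring
        simp only [this, Finset.sum_add_distrib, ← Finset.mul_sum, hdQ, gradSq]
        simp
        ring
      simp only [hdP, Finset.sum_add_distrib, h2, lap, Finset.sum_mul]
    rw [h1, hdS, hm]
    ring
  have hiP : ∀ j, Integrable (pderiv j (P j)) := fun j =>
    (smooth_pderiv (hsP j) j).integrable (hasCompactSupport_pderiv (hcP j) j)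
  have hiQ : Integrable (pderiv i Q) :=
    (smooth_pderiv hsQ i).integrable (hasCompactSupport_pderiv hcQ i)
  have hiS : Integrable (pderiv i S) :=
    (smooth_pderiv hsS i).integrable (hasCompactSupport_pderiv hcS i)
  have hiM : Integrable fun x => 2 * τ * pderiv i v x ^ 2 + 2 * τ ^ 3 * a x ^ 2 * v x ^ 2 := by
    refine Smooth.integrable ((contDiff_const.mul ((hD i).pow 2)).add
      ((contDiff_const.mul (hsa.pow 2)).mul (hv.pow 2))) ?_
    exact HasCompactSupport.intro' (K := tsupport v) hc (isClosed_tsupport v) fun x hx => by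
      rw [pderiv_eq_zero_of_eventuallyEq (notMem_tsupport_iff_eventuallyEq.1 hx) i,
        image_eq_zero_of_notMem_tsupport hx]
      simp
  have hisum : Integrable fun x => ∑ j, pderiv j (P j) x :=
    integrable_finsetSum _ fun j _ => hiP j
  have hiPQ : Integrable fun x => -τ * ∑ j, pderiv j (P j) x + τ * pderiv i Q x :=
    (hisum.const_mul _).add (hiQ.const_mul _)
  have hidiv : Integrable fun x => -τ * ∑ j, pderiv j (P j) x + τ * pderiv i Q x -
      τ ^ 3 * pderiv i S x := hiPQ.sub (hiS.const_mul _)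
  simp only [hpt]
  rw [integral_add hiM hidiv,
    integral_sub hiPQ (hiS.const_mul _),
    integral_add (hisum.const_mul _) (hiQ.const_mul _), integral_const_mul, integral_const_mul,
    integral_const_mul, integral_finsetSum _ fun j _ => hiP j,
    integral_pderiv_eq_zero hsQ hcQ, integral_pderiv_eq_zero hsS hcS,
    Finset.sum_eq_zero fun j _ => integral_pderiv_eq_zero (hsP j) (hcP j) j]
  simp

/-- Carleman inequality with the convex quadratic weight `τ a² / 2`, `a = xᵢ + s`. -/
theorem carleman_quadratic (i : Fin d) (s : ℝ) {τ : ℝ} (hτ : 0 ≤ τ) {f : Rd d → ℝ}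
    (hf : Smooth f) (hc : HasCompactSupport f) :
    8 * τ ^ 3 * ∫ x, Real.exp (τ * affineCoord i s x ^ 2) * (affineCoord i s x ^ 2 * f x ^ 2) ≤
      ∫ x, Real.exp (τ * affineCoord i s x ^ 2) * lap f x ^ 2 := by
  set a := affineCoord i s with ha
  have hsa : Smooth a := smooth_affineCoord i s
  have hda : ∀ j, pderiv j a = fun _ => if i = j then 1 else 0 := fun j => pderiv_affineCoord i j s
  set w : Rd d → ℝ := fun x => Real.exp (τ / 2 * (a x * a x)) with hw
  have hsw : Smooth w := (contDiff_const.mul (hsa.mul hsa)).exp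
  have hwsq : ∀ x, Real.exp (τ * a x ^ 2) = w x ^ 2 := fun x => by
    rw [hw, ← Real.exp_nat_mul]; congr 1; push_cast; ring
  have hdw : ∀ j, pderiv j w = fun x => w x * (τ * (if i = j then 1 else 0) * a x) := by
    intro j
    rw [hw, pderiv_comp Real.hasDerivAt_exp (contDiff_const.mul (hsa.mul hsa)),
      pderiv_const_mul _ (hsa.mul hsa), pderiv_mul hsa hsa, hda]
    ext x
    ring
  have hlw : ∀ x, lap w x = w x * (τ ^ 2 * a x ^ 2 + τ) := by
    intro x
    have : ∀ j, pderiv j (pderiv j w) x =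
        if i = j then w x * (τ ^ 2 * a x ^ 2 + τ) else 0 := by
      intro j
      rw [hdw, pderiv_mul hsw (contDiff_const.mul hsa), pderiv_const_mul _ hsa, hda, hdw]
      split_ifs <;> ring
    simp [lap, this]
  set v : Rd d → ℝ := fun x => w x * f x with hv
  have hsv : Smooth v := hsw.mul hf
  have hcv : HasCompactSupport v := hc.mul_left
  have hdv : pderiv i v = fun x => w x * (τ * a x * f x + pderiv i f x) := by
    rw [hv, pderiv_mul hsw hf, hdw]
    ext x
    simp
    ring
  have hlv : ∀ x, lap v x = w x * (lap f x + 2 * τ * a x * pderiv i f x +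
      (τ ^ 2 * a x ^ 2 + τ) * f x) := by
    intro x
    rw [hv, lap_mul hsw hf, hlw]
    have : ∑ j, pderiv j w x * pderiv j f x = w x * τ * a x * pderiv i f x := by
      simp only [hdw]
      rw [Finset.sum_eq_single i]
      · simp only [if_true]; ring
      · intro j _ hj; simp [hj.symm]
      · simp
    rw [this]
    ring
  -- Conjugation by `w = e^{τa²/2}`: with `v = wf`, `w Δ(v/w) = Sv + Av`, where `S = Δ + τ²a²` is
  -- symmetric and `A = -τ(2a∂ᵢ + 1)` antisymmetric.
  have hP : ∀ x, w x * lap f x = (lap v x + τ ^ 2 * a x ^ 2 * v x) +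
      (-τ * (2 * a x * pderiv i v x + v x)) := by
    intro x
    rw [hlv, hdv]
    simp only [hv]
    ring
  have hi1 : Integrable fun x => Real.exp (τ * a x ^ 2) * lap f x ^ 2 :=
    Smooth.integrable ((contDiff_const.mul (hsa.pow 2)).exp.mul ((smooth_lap hf).pow 2))
      (hasCompactSupport_sq (hasCompactSupport_lap hc)).mul_left
  have hi2 : Integrable fun x => (lap v x + τ ^ 2 * a x ^ 2 * v x) *
      (-τ * (2 * a x * pderiv i v x + v x)) := by
    refine Smooth.integrable (((smooth_lap hsv).add ((contDiff_const.mul (hsa.pow 2)).mul hsv)).mul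
      (contDiff_const.mul (((contDiff_const.mul hsa).mul (smooth_pderiv hsv i)).add hsv))) ?_
    exact HasCompactSupport.mul_right ((hasCompactSupport_lap hcv).add hcv.mul_left)
  have hi3 : Integrable fun x => Real.exp (τ * a x ^ 2) * (a x ^ 2 * f x ^ 2) :=
    Smooth.integrable ((contDiff_const.mul (hsa.pow 2)).exp.mul ((hsa.pow 2).mul (hf.pow 2)))
      (hasCompactSupport_sq hc).mul_left.mul_left
  have hi4 : Integrable fun x => 2 * τ * pderiv i v x ^ 2 + 2 * τ ^ 3 * a x ^ 2 * v x ^ 2 := by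
    refine Smooth.integrable ((contDiff_const.mul ((smooth_pderiv hsv i).pow 2)).add
      ((contDiff_const.mul (hsa.pow 2)).mul (hsv.pow 2))) ?_
    exact HasCompactSupport.intro' (K := tsupport v) hcv (isClosed_tsupport v) fun x hx => by
      rw [pderiv_eq_zero_of_eventuallyEq (notMem_tsupport_iff_eventuallyEq.1 hx) i,
        image_eq_zero_of_notMem_tsupport hx]
      simp
  calc 8 * τ ^ 3 * ∫ x, Real.exp (τ * a x ^ 2) * (a x ^ 2 * f x ^ 2)
      = ∫ x, 8 * τ ^ 3 * (Real.exp (τ * a x ^ 2) * (a x ^ 2 * f x ^ 2)) :=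
        (integral_const_mul _ _).symm
    _ ≤ ∫ x, 4 * (2 * τ * pderiv i v x ^ 2 + 2 * τ ^ 3 * a x ^ 2 * v x ^ 2) := by
        refine integral_mono (hi3.const_mul _) (hi4.const_mul _) fun x => ?_
        have : 0 ≤ τ * pderiv i v x ^ 2 := by positivity
        simp only [hwsq, hv] at this ⊢
        linarith
    _ = ∫ x, 4 * ((lap v x + τ ^ 2 * a x ^ 2 * v x) *
          (-τ * (2 * a x * pderiv i v x + v x))) := by
        rw [integral_const_mul, integral_const_mul, integral_commutator i s τ hsv hcv]
    _ ≤ ∫ x, Real.exp (τ * a x ^ 2) * lap f x ^ 2 := by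
        refine integral_mono (hi2.const_mul _) hi1 fun x => ?_
        simp only [hwsq, ← mul_pow, hP]
        -- `(S + A)² ≥ 4SA`, because the difference is `(S - A)²`.
        nlinarith [sq_nonneg ((lap v x + τ ^ 2 * a x ^ 2 * v x) -
          (-τ * (2 * a x * pderiv i v x + v x)))]

end Carleman

/-! ### Bounded weights, the class for which weighted `L²` forms are continuous on `L²`. -/

section Weights

variable {d : ℕ}

/-- Bounded measurable weights. -/
structure IsBddWeight (w : Rd d → ℝ) : Prop where
  measurable : Measurable w
  bounded : ∃ C, ∀ x, |w x| ≤ C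

namespace IsBddWeight

variable {v w : Rd d → ℝ}

theorem integrable_mul (hw : IsBddWeight w) {g : Rd d → ℝ} (hg : Integrable g) :
    Integrable fun x => w x * g x := by
  obtain ⟨C, hC⟩ := hw.bounded
  exact hg.bdd_mul hw.measurable.aestronglyMeasurable (Filter.Eventually.of_forall hC)

theorem add (hv : IsBddWeight v) (hw : IsBddWeight w) : IsBddWeight fun x => v x + w x := by
  obtain ⟨C, hC⟩ := hv.bounded
  obtain ⟨D, hD⟩ := hw.bounded
  exact ⟨hv.measurable.add hw.measurable, C + D, fun x =>
    (abs_add_le _ _).trans (add_le_add (hC x) (hD x))⟩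

theorem const_mul (c : ℝ) (hw : IsBddWeight w) : IsBddWeight fun x => c * w x := by
  obtain ⟨C, hC⟩ := hw.bounded
  exact ⟨hw.measurable.const_mul c, |c| * C, fun x => by
    rw [abs_mul]; exact mul_le_mul_of_nonneg_left (hC x) (abs_nonneg c)⟩

theorem sub (hv : IsBddWeight v) (hw : IsBddWeight w) : IsBddWeight fun x => v x - w x := by
  simpa [sub_eq_add_neg] using hv.add (hw.const_mul (-1))

theorem abs (hw : IsBddWeight w) : IsBddWeight fun x => |w x| := by
  obtain ⟨C, hC⟩ := hw.bounded
  exact ⟨hw.measurable.norm, C, fun x => by simpa using hC x⟩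

theorem of_continuous (hw : Continuous w) (hc : HasCompactSupport w) : IsBddWeight w := by
  obtain ⟨C, hC⟩ := hw.bounded_above_of_compact_support hc
  exact ⟨hw.measurable, C, hC⟩

theorem indicator_one {s : Set (Rd d)} (hs : MeasurableSet s) :
    IsBddWeight (s.indicator fun _ => (1 : ℝ)) :=
  ⟨measurable_const.indicator hs, 1, fun x => by
    by_cases h : x ∈ s <;> simp [h]⟩

end IsBddWeight

end Weights

/-! ### Radial cutoffs with scale-invariant derivative bounds. -/

section Cutoff

variable {d : ℕ}

/-- The open ring `r < |x| < R`. -/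
def openRing (d : ℕ) (r R : ℝ) : Set (Rd d) := {x | r < ‖x‖ ∧ ‖x‖ < R}

theorem measurableSet_openRing (r R : ℝ) : MeasurableSet (openRing d r R) :=
  (measurableSet_lt measurable_const measurable_norm).inter
    (measurableSet_lt measurable_norm measurable_const)

/-- `χ` is a smooth cutoff from the ball of radius `r` to the ball of radius `R`, with the natural
bounds on its derivatives. -/
structure IsCutoff (K r R : ℝ) (χ : Rd d → ℝ) : Prop where
  smooth : Smooth χ
  nonneg : ∀ x, 0 ≤ χ x
  le_one : ∀ x, χ x ≤ 1
  eq_one : ∀ x, ‖x‖ ≤ r → χ x = 1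
  eq_zero : ∀ x, R ≤ ‖x‖ → χ x = 0
  gradSq_le : ∀ x, gradSq χ x ≤ K / (R - r) ^ 2
  lap_le : ∀ x, |lap χ x| ≤ K / (R - r) ^ 2
  gradSq_eq_zero : ∀ x ∉ openRing d r R, gradSq χ x = 0
  lap_eq_zero : ∀ x ∉ openRing d r R, lap χ x = 0

theorem eq_zero_of_eqOn_zero_compl_Icc {h : ℝ → ℝ} (hh : Continuous h)
    (h0 : ∀ t, t < 0 → h t = 0) (h1 : ∀ t, 1 < t → h t = 0) (t : ℝ) (ht : t ≤ 0 ∨ 1 ≤ t) :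
    h t = 0 := by
  have hcl : IsClosed {t | h t = 0} := isClosed_eq hh continuous_const
  rcases ht with ht | ht
  · have : closure (Set.Iio (0 : ℝ)) ⊆ {t | h t = 0} := hcl.closure_subset_iff.2 h0
    exact this (by rw [closure_Iio]; exact ht)
  · have : closure (Set.Ioi (1 : ℝ)) ⊆ {t | h t = 0} := hcl.closure_subset_iff.2 h1
    exact this (by rw [closure_Ioi]; exact ht)

theorem exists_bound_of_eq_zero_compl_Icc {h : ℝ → ℝ} (hh : Continuous h)
    (h0 : ∀ t, t ≤ 0 ∨ 1 ≤ t → h t = 0) : ∃ M, ∀ t, |h t| ≤ M :=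
  hh.bounded_above_of_compact_support
    (HasCompactSupport.intro (K := Set.Icc 0 1) isCompact_Icc fun t ht => h0 t (by
      by_contra hcon
      push Not at hcon
      exact ht ⟨hcon.1.le, hcon.2.le⟩))

/-- The transition is constant outside `[0, 1]`, so its derivatives vanish there, at the endpoints
by continuity. They are therefore compactly supported and bounded. -/
theorem exists_smoothTransition_bounds : ∃ M : ℝ, 0 ≤ M ∧
    (∀ t, |deriv Real.smoothTransition t| ≤ M) ∧
    (∀ t, |deriv (deriv Real.smoothTransition) t| ≤ M) ∧
    ∀ t, t ≤ 0 ∨ 1 ≤ t → deriv Real.smoothTransition t = 0 ∧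
      deriv (deriv Real.smoothTransition) t = 0 := by
  have hs : ContDiff ℝ (⊤ : ℕ∞) Real.smoothTransition := Real.smoothTransition.contDiff
  have hs1 : ContDiff ℝ (⊤ : ℕ∞) (deriv Real.smoothTransition) :=
    ContDiff.iterate_deriv 1 hs
  have hs2 : ContDiff ℝ (⊤ : ℕ∞) (deriv (deriv Real.smoothTransition)) :=
    ContDiff.iterate_deriv 2 hs
  have e0 : ∀ t < 0, Real.smoothTransition =ᶠ[nhds t] fun _ => (0 : ℝ) := fun t ht => by
    filter_upwards [Iio_mem_nhds ht] with y hy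
    exact Real.smoothTransition.zero_of_nonpos (le_of_lt hy)
  have e1 : ∀ t, 1 < t → Real.smoothTransition =ᶠ[nhds t] fun _ => (1 : ℝ) := fun t ht => by
    filter_upwards [Ioi_mem_nhds ht] with y hy
    exact Real.smoothTransition.one_of_one_le (le_of_lt hy)
  have z1 := eq_zero_of_eqOn_zero_compl_Icc hs1.continuous
    (fun t ht => by rw [(e0 t ht).deriv_eq]; simp) (fun t ht => by rw [(e1 t ht).deriv_eq]; simp)
  have z2 := eq_zero_of_eqOn_zero_compl_Icc hs2.continuous
    (fun t ht => by rw [(e0 t ht).deriv.deriv_eq]; simp)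
    (fun t ht => by rw [(e1 t ht).deriv.deriv_eq]; simp)
  obtain ⟨M₁, h₁⟩ := exists_bound_of_eq_zero_compl_Icc hs1.continuous z1
  obtain ⟨M₂, h₂⟩ := exists_bound_of_eq_zero_compl_Icc hs2.continuous z2
  exact ⟨max M₁ M₂, ((abs_nonneg _).trans (h₁ 0)).trans (le_max_left _ _),
    fun t => (h₁ t).trans (le_max_left _ _), fun t => (h₂ t).trans (le_max_right _ _),
    fun t ht => ⟨z1 t ht, z2 t ht⟩⟩

/-- The cutoff is `θ((R² - |x|²) / (R² - r²))`; using `|x|²` rather than `|x|` keeps it smooth at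
the origin, including when `r = 0`. One `K` serves every ring, since `R / (R² - r²) ≤ 1 / (R - r)`
and `1 / (R² - r²) ≤ 1 / (R - r)²`. -/
theorem exists_isCutoff (d : ℕ) : ∃ K : ℝ, 0 ≤ K ∧ ∀ r R : ℝ, 0 ≤ r → r < R →
    ∃ χ : Rd d → ℝ, IsCutoff K r R χ := by
  obtain ⟨M, hM0, hM1, hM2, hM⟩ := exists_smoothTransition_bounds
  set θ := Real.smoothTransition
  have hs : ContDiff ℝ (⊤ : ℕ∞) θ := Real.smoothTransition.contDiff
  have hs1 : ContDiff ℝ (⊤ : ℕ∞) (deriv θ) := ContDiff.iterate_deriv 1 hs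
  have hθ1 : ∀ t, HasDerivAt θ (deriv θ t) t := fun t =>
    (hs.differentiable (by simp) t).hasDerivAt
  have hθ2 : ∀ t, HasDerivAt (deriv θ) (deriv (deriv θ) t) t := fun t =>
    (hs1.differentiable (by simp) t).hasDerivAt
  refine ⟨4 * M ^ 2 + (4 + 2 * d) * M, by positivity, fun r R hr hrR => ?_⟩
  have hR : 0 < R := hr.trans_lt hrR
  have hw : 0 < R - r := sub_pos.2 hrR
  set c : ℝ := (R ^ 2 - r ^ 2)⁻¹ with hc
  have hD : 0 < R ^ 2 - r ^ 2 := by nlinarith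
  have hc0 : 0 < c := inv_pos.2 hD
  have hcR : c * R ≤ (R - r)⁻¹ := by
    rw [hc, inv_mul_le_iff₀ hD, le_mul_inv_iff₀ hw]
    nlinarith
  have hcw : c ≤ (R - r)⁻¹ ^ 2 := by
    rw [hc, inv_pow]
    refine inv_anti₀ (by positivity) ?_
    nlinarith
  let X : Fin d → Rd d → ℝ := fun i x => affineCoord i 0 x
  have hX : ∀ i, Smooth (X i) := fun i => smooth_affineCoord i 0
  have hdX : ∀ i j, pderiv j (X i) = fun _ => if i = j then 1 else 0 :=
    fun i j => pderiv_affineCoord i j 0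
  have hnorm : ∀ x : Rd d, ∑ i, X i x * X i x = ‖x‖ ^ 2 := by
    intro x
    rw [EuclideanSpace.norm_sq_eq]
    exact Finset.sum_congr rfl fun i _ => by simp [X, affineCoord, sq]
  set N : Rd d → ℝ := fun x => ∑ i, X i x * X i x with hN
  have hsN : Smooth N := ContDiff.sum fun i _ => (hX i).mul (hX i)
  have hdN : ∀ j, pderiv j N = fun x => 2 * X j x := by
    intro j
    rw [hN, pderiv_sum _ fun i => (hX i).mul (hX i)]
    ext x
    rw [Finset.sum_eq_single j]
    · rw [pderiv_mul (hX j) (hX j), hdX]; simp; ring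
    · intro i _ hi
      rw [pderiv_mul (hX i) (hX i), hdX]; simp [hi]
    · simp
  set q : Rd d → ℝ := fun x => c * R ^ 2 - c * N x with hq
  have hsq : Smooth q := contDiff_const.sub (contDiff_const.mul hsN)
  have hdq : ∀ j, pderiv j q = fun x => -(2 * c) * X j x := by
    intro j
    rw [hq, pderiv_sub (f := fun _ => c * R ^ 2) contDiff_const (contDiff_const.mul hsN),
      pderiv_const_mul _ hsN, hdN]
    ext x
    have : pderiv j (fun _ : Rd d => c * R ^ 2) x = 0 := by simp [pderiv]
    rw [this]; ring
  have hsθ1 : Smooth fun x => deriv θ (q x) := hs1.comp hsq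
  have hdχ : ∀ j, pderiv j (fun x => θ (q x)) = fun x => deriv θ (q x) * (-(2 * c) * X j x) := by
    intro j
    rw [pderiv_comp hθ1 hsq, hdq]
  have hg : ∀ x, gradSq (fun x => θ (q x)) x = 4 * c ^ 2 * deriv θ (q x) ^ 2 * ‖x‖ ^ 2 := by
    intro x
    rw [← hnorm, Finset.mul_sum]
    refine Finset.sum_congr rfl fun j _ => ?_
    rw [hdχ]; ring
  have hl : ∀ x, lap (fun x => θ (q x)) x =
      4 * c ^ 2 * deriv (deriv θ) (q x) * ‖x‖ ^ 2 - 2 * c * d * deriv θ (q x) := by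
    intro x
    have : ∀ j, pderiv j (pderiv j fun x => θ (q x)) x =
        4 * c ^ 2 * deriv (deriv θ) (q x) * (X j x * X j x) - 2 * c * deriv θ (q x) := by
      intro j
      rw [hdχ, pderiv_mul hsθ1 (contDiff_const.mul (hX j)), pderiv_const_mul _ (hX j), hdX,
        pderiv_comp hθ2 hsq, hdq]
      simp
      ring
    simp only [lap, this, Finset.sum_sub_distrib, ← Finset.mul_sum, hnorm]
    simp
    ring
  have hq1 : ∀ x : Rd d, ‖x‖ ≤ r → 1 ≤ q x := by
    intro x hx
    have h2 : ‖x‖ ^ 2 ≤ r ^ 2 := pow_le_pow_left₀ (norm_nonneg x) hx 2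
    have h3 : q x = c * (R ^ 2 - ‖x‖ ^ 2) := by simp only [hq, hN, hnorm]; ring
    rw [h3, hc, ← div_eq_inv_mul, one_le_div hD]
    linarith
  have hq0 : ∀ x : Rd d, R ≤ ‖x‖ → q x ≤ 0 := by
    intro x hx
    have h2 : R ^ 2 ≤ ‖x‖ ^ 2 := pow_le_pow_left₀ hR.le hx 2
    have h3 : q x = c * (R ^ 2 - ‖x‖ ^ 2) := by simp only [hq, hN, hnorm]; ring
    rw [h3]
    exact mul_nonpos_of_nonneg_of_nonpos hc0.le (by linarith)
  have hout : ∀ x ∉ openRing d r R, deriv θ (q x) = 0 ∧ deriv (deriv θ) (q x) = 0 := by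
    intro x hx
    refine hM _ ?_
    by_cases h : ‖x‖ ≤ r
    · exact Or.inr (hq1 x h)
    · exact Or.inl (hq0 x (not_lt.1 fun h' => hx ⟨not_le.1 h, h'⟩))
  have hgz : ∀ x ∉ openRing d r R, gradSq (fun x => θ (q x)) x = 0 := fun x hx => by
    rw [hg, (hout x hx).1]; simp
  have hlz : ∀ x ∉ openRing d r R, lap (fun x => θ (q x)) x = 0 := fun x hx => by
    rw [hl, (hout x hx).1, (hout x hx).2]; simp
  have hcx : ∀ x ∈ openRing d r R, c ^ 2 * ‖x‖ ^ 2 ≤ (R - r)⁻¹ ^ 2 := by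
    intro x hx
    rw [← mul_pow]
    refine pow_le_pow_left₀ (by positivity) (le_trans ?_ hcR) 2
    exact mul_le_mul_of_nonneg_left hx.2.le hc0.le
  refine ⟨fun x => θ (q x), hs.comp hsq, fun x => Real.smoothTransition.nonneg _,
    fun x => Real.smoothTransition.le_one _,
    fun x hx => Real.smoothTransition.one_of_one_le (hq1 x hx),
    fun x hx => Real.smoothTransition.zero_of_nonpos (hq0 x hx), fun x => ?_, fun x => ?_, hgz, hlz⟩
  · by_cases hx : x ∈ openRing d r R
    · rw [hg, div_eq_mul_inv, ← inv_pow]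
      have h1 : deriv θ (q x) ^ 2 ≤ M ^ 2 := sq_le_sq' (abs_le.1 (hM1 _)).1 (abs_le.1 (hM1 _)).2
      calc 4 * c ^ 2 * deriv θ (q x) ^ 2 * ‖x‖ ^ 2
          = 4 * deriv θ (q x) ^ 2 * (c ^ 2 * ‖x‖ ^ 2) := by ring
        _ ≤ 4 * M ^ 2 * (R - r)⁻¹ ^ 2 := by gcongr; exact hcx x hx
        _ ≤ _ := by gcongr; simp; positivity
    · rw [hgz x hx]; positivity
  · by_cases hx : x ∈ openRing d r R
    · rw [hl, div_eq_mul_inv, ← inv_pow]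
      calc |4 * c ^ 2 * deriv (deriv θ) (q x) * ‖x‖ ^ 2 - 2 * c * d * deriv θ (q x)|
          ≤ |4 * c ^ 2 * deriv (deriv θ) (q x) * ‖x‖ ^ 2| + |2 * c * d * deriv θ (q x)| :=
            abs_sub _ _
        _ = 4 * |deriv (deriv θ) (q x)| * (c ^ 2 * ‖x‖ ^ 2) + 2 * d * |deriv θ (q x)| * c := by
            simp only [abs_mul, abs_of_pos hc0, abs_pow, abs_norm, Nat.abs_cast]
            simp
            ring
        _ ≤ 4 * M * (R - r)⁻¹ ^ 2 + 2 * d * M * (R - r)⁻¹ ^ 2 := by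
            gcongr
            · exact hM2 _
            · exact hcx x hx
            · exact hM1 _
        _ ≤ _ := by nlinarith [mul_nonneg (sq_nonneg M) (sq_nonneg (R - r)⁻¹)]
    · rw [hlz x hx]; simp; positivity

namespace IsCutoff

variable {K r R : ℝ} {χ : Rd d → ℝ}

theorem hasCompactSupport (h : IsCutoff K r R χ) : HasCompactSupport χ :=
  HasCompactSupport.intro (isCompact_closedBall (0 : Rd d) R) fun x hx => h.eq_zero x (by
    rw [mem_closedBall_zero_iff] at hx
    exact (not_le.1 hx).le)

/-- The left side is the square of the commutator `[Δ, χ] p`. It is confined to the ring, and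
Cauchy–Schwarz together with `(a + b)² ≤ 2a² + 2b²` produces the factors `8` and `2`. -/
theorem sq_comm_le (h : IsCutoff K r R χ) (p : Rd d → ℝ) (x : Rd d) :
    (2 * ∑ i, pderiv i χ x * pderiv i p x + p x * lap χ x) ^ 2 ≤
      (openRing d r R).indicator (fun _ => (1 : ℝ)) x *
        (8 * (K / (R - r) ^ 2) * gradSq p x + 2 * (K / (R - r) ^ 2) ^ 2 * p x ^ 2) := by
  have hcs : (∑ i, pderiv i χ x * pderiv i p x) ^ 2 ≤ gradSq χ x * gradSq p x :=
    Finset.sum_mul_sq_le_sq_mul_sq _ _ _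
  by_cases hx : x ∈ openRing d r R
  · rw [Set.indicator_of_mem hx, one_mul]
    have h1 : gradSq χ x * gradSq p x ≤ K / (R - r) ^ 2 * gradSq p x :=
      mul_le_mul_of_nonneg_right (h.gradSq_le x) (gradSq_nonneg p x)
    have h2 : lap χ x ^ 2 ≤ (K / (R - r) ^ 2) ^ 2 :=
      sq_le_sq' (abs_le.1 (h.lap_le x)).1 (abs_le.1 (h.lap_le x)).2
    nlinarith [sq_nonneg (2 * ∑ i, pderiv i χ x * pderiv i p x - p x * lap χ x),
      mul_le_mul_of_nonneg_right h2 (sq_nonneg (p x))]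
  · rw [h.gradSq_eq_zero x hx, zero_mul] at hcs
    have : ∑ i, pderiv i χ x * pderiv i p x = 0 := by
      nlinarith [sq_nonneg (∑ i, pderiv i χ x * pderiv i p x)]
    rw [this, h.lap_eq_zero x hx, Set.indicator_of_notMem hx]
    simp

end IsCutoff

end Cutoff

/-! ### Carleman and Caccioppoli inequalities as nonnegativity of quadratic forms in `p`, `∇p`,
`Δp`. -/

section SmoothInequalities

variable {d : ℕ}

/-- Carleman inequality for the product of a cutoff and a smooth function. -/
theorem carleman_cutoff (i : Fin d) {K r R τ : ℝ} (hR : 0 < R) (hτ : 0 ≤ τ)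
    {χ : Rd d → ℝ} (hχ : IsCutoff K r R χ) {p : Rd d → ℝ} (hp : Smooth p)
    (h0 : Integrable fun x => p x ^ 2) (h1 : Integrable (gradSq p))
    (h2 : Integrable fun x => lap p x ^ 2) :
    0 ≤ ∫ x, (4 * (K / (R - r) ^ 2) ^ 2 * Real.exp (9 * τ * R ^ 2) *
            (openRing d r R).indicator (fun _ => (1 : ℝ)) x -
          8 * τ ^ 3 * R ^ 2 * (Real.exp (τ * affineCoord i (2 * R) x ^ 2) * χ x ^ 2)) * p x ^ 2 +
        (16 * (K / (R - r) ^ 2) * Real.exp (9 * τ * R ^ 2) *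
            (openRing d r R).indicator (fun _ => (1 : ℝ)) x) * gradSq p x +
        (2 * (Real.exp (τ * affineCoord i (2 * R) x ^ 2) * χ x ^ 2)) * lap p x ^ 2 := by
  set a := affineCoord i (2 * R) with ha
  have hsa : Smooth a := smooth_affineCoord i (2 * R)
  have hsE : Smooth fun x => Real.exp (τ * a x ^ 2) := (contDiff_const.mul (hsa.pow 2)).exp
  set I : Rd d → ℝ := (openRing d r R).indicator (fun _ => (1 : ℝ)) with hI
  have hI0 : IsBddWeight I := .indicator_one (measurableSet_openRing r R)
  have hW : IsBddWeight fun x => Real.exp (τ * a x ^ 2) * χ x ^ 2 :=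
    .of_continuous (hsE.mul (hχ.smooth.pow 2)).continuous
      (hasCompactSupport_sq hχ.hasCompactSupport).mul_left
  have hf : Smooth fun x => χ x * p x := hχ.smooth.mul hp
  have hfc : HasCompactSupport fun x => χ x * p x := hχ.hasCompactSupport.mul_right
  have hC := carleman_quadratic i (2 * R) hτ hf hfc
  rw [← ha, ← integral_const_mul, ← sub_nonneg] at hC
  have hi1 : Integrable fun x => Real.exp (τ * a x ^ 2) * lap (fun x => χ x * p x) x ^ 2 :=
    Smooth.integrable (hsE.mul ((smooth_lap hf).pow 2))
      (hasCompactSupport_sq (hasCompactSupport_lap hfc)).mul_left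
  have hi2 : Integrable fun x =>
      8 * τ ^ 3 * (Real.exp (τ * a x ^ 2) * (a x ^ 2 * (χ x * p x) ^ 2)) :=
    (Smooth.integrable (hsE.mul ((hsa.pow 2).mul (hf.pow 2)))
      (hasCompactSupport_sq hfc).mul_left.mul_left).const_mul _
  rw [← integral_sub hi1 hi2] at hC
  refine hC.trans (integral_mono (hi1.sub hi2) ?_ fun x => ?_)
  · exact ((((hI0.const_mul _).sub (hW.const_mul _)).integrable_mul h0).add
      ((hI0.const_mul _).integrable_mul h1)).add ((hW.const_mul _).integrable_mul h2)
  · have hpos : 0 < Real.exp (τ * a x ^ 2) := Real.exp_pos _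
    -- `Δ(χp) = χΔp + [Δ, χ]p`. Only the commutator falls outside the term that is absorbed later.
    have hsplit : lap (fun x => χ x * p x) x ^ 2 ≤ 2 * (χ x ^ 2 * lap p x ^ 2) +
        2 * (I x * (8 * (K / (R - r) ^ 2) * gradSq p x +
          2 * (K / (R - r) ^ 2) ^ 2 * p x ^ 2)) := by
      rw [lap_mul hχ.smooth hp]
      have := hχ.sq_comm_le p x
      nlinarith [sq_nonneg (χ x * lap p x -
        (2 * ∑ i, pderiv i χ x * pderiv i p x + p x * lap χ x))]
    -- The shift `2R` gives `R ≤ a ≤ 3R` on the ball of radius `R`: the upper bound yields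
    -- `e^{9τR²}`, the lower one the factor `R²` on the left.
    have hcoord : |x i| ≤ ‖x‖ := by
      simpa using PiLp.norm_apply_le x i
    have hax : a x = x i + 2 * R := rfl
    have hB : 0 ≤ 8 * (K / (R - r) ^ 2) * gradSq p x + 2 * (K / (R - r) ^ 2) ^ 2 * p x ^ 2 := by
      have := (gradSq_nonneg χ x).trans (hχ.gradSq_le x)
      have := gradSq_nonneg p x
      positivity
    have hE : Real.exp (τ * a x ^ 2) * (I x * (8 * (K / (R - r) ^ 2) * gradSq p x +
        2 * (K / (R - r) ^ 2) ^ 2 * p x ^ 2)) ≤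
        Real.exp (9 * τ * R ^ 2) * (I x * (8 * (K / (R - r) ^ 2) * gradSq p x +
        2 * (K / (R - r) ^ 2) ^ 2 * p x ^ 2)) := by
      by_cases hx : x ∈ openRing d r R
      · have hIx : 0 ≤ I x := by simp [hI, hx]
        refine mul_le_mul_of_nonneg_right (Real.exp_le_exp.2 ?_) (mul_nonneg hIx hB)
        have h3 := abs_le.1 (hcoord.trans hx.2.le)
        have : a x ^ 2 ≤ 9 * R ^ 2 := by rw [hax]; nlinarith
        nlinarith
      · simp [hI, hx]
    have hlow : R ^ 2 * χ x ^ 2 ≤ a x ^ 2 * χ x ^ 2 := by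
      by_cases hx : R ≤ ‖x‖
      · simp [hχ.eq_zero x hx]
      · have h3 := abs_le.1 (hcoord.trans (not_le.1 hx).le)
        refine mul_le_mul_of_nonneg_right ?_ (sq_nonneg _)
        rw [hax]; nlinarith
    have hlow' : 8 * τ ^ 3 * (Real.exp (τ * a x ^ 2) * p x ^ 2) * (R ^ 2 * χ x ^ 2) ≤
        8 * τ ^ 3 * (Real.exp (τ * a x ^ 2) * p x ^ 2) * (a x ^ 2 * χ x ^ 2) :=
      mul_le_mul_of_nonneg_left hlow (by positivity)
    have hsplit' := mul_le_mul_of_nonneg_left hsplit hpos.le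
    simp only
    linarith

/-- Caccioppoli inequality. -/
theorem caccioppoli {ξ p : Rd d → ℝ} (hξ : Smooth ξ) (hc : HasCompactSupport ξ)
    (hξ0 : ∀ x, 0 ≤ ξ x) {ε : ℝ} (hε : 0 < ε) (hp : Smooth p) :
    0 ≤ ∫ x, (|lap ξ x| + ε * ξ x) * p x ^ 2 + (-2 * ξ x) * gradSq p x +
      (ε⁻¹ * ξ x) * lap p x ^ 2 := by
  have hD := fun i => smooth_pderiv hp i
  have hDξ := fun i => smooth_pderiv hξ i
  set P : Fin d → Rd d → ℝ := fun i x => ξ x * (p x * pderiv i p x) with hP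
  set Q : Fin d → Rd d → ℝ := fun i x => pderiv i ξ x * (p x * p x) with hQ
  have hsP : ∀ i, Smooth (P i) := fun i => hξ.mul (hp.mul (hD i))
  have hsQ : ∀ i, Smooth (Q i) := fun i => (hDξ i).mul (hp.mul hp)
  have hcP : ∀ i, HasCompactSupport (P i) := fun i => hc.mul_right
  have hcQ : ∀ i, HasCompactSupport (Q i) := fun i => (hasCompactSupport_pderiv hc i).mul_right
  have hiP : ∀ i, Integrable (pderiv i (P i)) := fun i =>
    (smooth_pderiv (hsP i) i).integrable (hasCompactSupport_pderiv (hcP i) i)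
  have hiQ : ∀ i, Integrable (pderiv i (Q i)) := fun i =>
    (smooth_pderiv (hsQ i) i).integrable (hasCompactSupport_pderiv (hcQ i) i)
  -- The two vector fields are combined so that the cross terms `∇ξ · p∇p` cancel; only `Δξ`
  -- survives.
  have hpt : ∀ x, ∑ i, (-2 * pderiv i (P i) x + pderiv i (Q i) x) =
      lap ξ x * p x ^ 2 - 2 * ξ x * gradSq p x - 2 * ξ x * p x * lap p x := by
    intro x
    simp only [lap, gradSq, Finset.sum_mul, Finset.mul_sum, ← Finset.sum_sub_distrib]
    refine Finset.sum_congr rfl fun i _ => ?_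
    rw [hP, hQ, pderiv_mul hξ (hp.mul (hD i)), pderiv_mul hp (hD i),
      pderiv_mul (hDξ i) (hp.mul hp), pderiv_mul hp hp]
    ring
  have hi : ∀ i, Integrable fun x => -2 * pderiv i (P i) x + pderiv i (Q i) x :=
    fun i => ((hiP i).const_mul _).add (hiQ i)
  have hzero : ∫ x, ∑ i, (-2 * pderiv i (P i) x + pderiv i (Q i) x) = 0 := by
    rw [integral_finsetSum _ fun i _ => hi i]
    refine Finset.sum_eq_zero fun i _ => ?_
    rw [integral_add ((hiP i).const_mul _) (hiQ i), integral_const_mul,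
      integral_pderiv_eq_zero (hsP i) (hcP i), integral_pderiv_eq_zero (hsQ i) (hcQ i)]
    simp
  rw [← hzero]
  refine integral_mono (integrable_finsetSum _ fun i _ => hi i) ?_ fun x => ?_
  · refine Continuous.integrable_of_hasCompactSupport ?_ ?_
    · have := (smooth_lap hξ).continuous
      have := (smooth_lap hp).continuous
      have := (smooth_gradSq hp).continuous
      have := hξ.continuous
      have := hp.continuous
      fun_prop
    · refine HasCompactSupport.intro' (K := tsupport ξ) hc (isClosed_tsupport ξ) fun x hx => ?_
      have hl : lap ξ x = 0 := by
        refine Finset.sum_eq_zero fun i _ => pderiv_eq_zero_of_eventuallyEq (c := 0) ?_ i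
        filter_upwards [(notMem_tsupport_iff_eventuallyEq.1 hx).eventuallyEq_nhds] with y hy
        exact pderiv_eq_zero_of_eventuallyEq hy i
      rw [hl, image_eq_zero_of_notMem_tsupport hx]
      simp
  · simp only [hpt]
    have h1 : lap ξ x * p x ^ 2 ≤ |lap ξ x| * p x ^ 2 :=
      mul_le_mul_of_nonneg_right (le_abs_self _) (sq_nonneg _)
    have h2 : -2 * p x * lap p x ≤ ε * p x ^ 2 + ε⁻¹ * lap p x ^ 2 := by
      have h3 : 0 ≤ ε⁻¹ * (ε * p x + lap p x) ^ 2 := by positivity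
      have h4 : ε⁻¹ * (ε * p x + lap p x) ^ 2 =
          ε * p x ^ 2 + 2 * p x * lap p x + ε⁻¹ * lap p x ^ 2 := by
        field_simp
        ring
      linarith
    nlinarith [mul_le_mul_of_nonneg_left h2 (hξ0 x)]

end SmoothInequalities

/-! ### `L²` bounds for the resolvent and its derivatives, by Plancherel. -/

section Multipliers

open FourierTransform

variable {d : ℕ}

theorem norm_toLp_fourierMultiplierCLM_le {g : Rd d → ℝ} (hg : g.HasTemperateGrowth) {C : ℝ}
    (hC : ∀ x, |g x| ≤ C) (f : 𝓢(Rd d, ℂ)) :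
    ‖(SchwartzMap.fourierMultiplierCLM ℂ g f).toLp 2‖ ≤ C * ‖f.toLp 2‖ := by
  have hC0 : 0 ≤ C := (abs_nonneg _).trans (hC 0)
  rw [← SchwartzMap.norm_fourier_toL2_eq, ← SchwartzMap.norm_fourier_toL2_eq f,
    SchwartzMap.fourierMultiplierCLM_apply, FourierTransform.fourier_fourierInv_eq]
  refine Lp.norm_le_mul_norm_of_ae_le_mul ?_
  filter_upwards [SchwartzMap.coeFn_toLp (SchwartzMap.smulLeftCLM ℂ g (𝓕 f)) 2 volume,
    SchwartzMap.coeFn_toLp (𝓕 f) 2 volume] with x h1 h2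
  rw [h1, h2, SchwartzMap.smulLeftCLM_apply_apply hg, norm_smul]
  exact mul_le_mul_of_nonneg_right (hC x) (norm_nonneg _)

/-- The symbol of `(1 - (2π)⁻² Δ)⁻¹`. -/
noncomputable def resolventSymbol (d : ℕ) : Rd d → ℝ := fun x => (1 + ‖x‖ ^ 2) ^ (-1 : ℝ)

theorem resolventSymbol_eq (x : Rd d) : resolventSymbol d x = (1 + ‖x‖ ^ 2)⁻¹ :=
  Real.rpow_neg_one _

theorem hasTemperateGrowth_resolventSymbol : (resolventSymbol d).HasTemperateGrowth :=
  Function.hasTemperateGrowth_one_add_norm_sq_rpow (Rd d) (-1)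

/-- The operator `(1 - (2π)⁻² Δ)⁻¹` on Schwartz functions. -/
noncomputable def laplaceResolvent (d : ℕ) : 𝓢(Rd d, ℂ) →L[ℝ] 𝓢(Rd d, ℂ) :=
  SchwartzMap.fourierMultiplierCLM ℂ (resolventSymbol d)

theorem norm_toLp_resolvent_le (f : 𝓢(Rd d, ℂ)) :
    ‖(laplaceResolvent d f).toLp 2‖ ≤ 1 * ‖f.toLp 2‖ := by
  refine norm_toLp_fourierMultiplierCLM_le hasTemperateGrowth_resolventSymbol (fun x => ?_) f
  rw [resolventSymbol_eq, abs_of_nonneg (by positivity)]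
  exact inv_le_one_of_one_le₀ (by nlinarith [sq_nonneg ‖x‖])

theorem norm_toLp_lineDeriv_resolvent_le (m : Rd d) (f : 𝓢(Rd d, ℂ)) :
    ‖(∂_{m} (laplaceResolvent d f)).toLp 2‖ ≤ (2 * Real.pi * ‖m‖) * ‖f.toLp 2‖ := by
  have hm : (fun x : Rd d => inner ℝ x m).HasTemperateGrowth := by fun_prop
  have h1 : ∂_{m} (laplaceResolvent d f) = (2 * Real.pi * Complex.I) •
      SchwartzMap.fourierMultiplierCLM ℂ ((fun x => inner ℝ x m) * resolventSymbol d) f := by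
    rw [SchwartzMap.lineDeriv_eq_fourierMultiplierCLM, laplaceResolvent,
      SchwartzMap.fourierMultiplierCLM_fourierMultiplierCLM_apply hm
        hasTemperateGrowth_resolventSymbol]
  have h2 : ‖(SchwartzMap.fourierMultiplierCLM ℂ
      ((fun x => inner ℝ x m) * resolventSymbol d) f).toLp 2‖ ≤ ‖m‖ * ‖f.toLp 2‖ := by
    refine norm_toLp_fourierMultiplierCLM_le (hm.mul hasTemperateGrowth_resolventSymbol)
      (fun x => ?_) f
    rw [Pi.mul_apply, abs_mul, resolventSymbol_eq, abs_of_nonneg (a := (1 + ‖x‖ ^ 2)⁻¹)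
      (by positivity), ← div_eq_mul_inv, div_le_iff₀ (by positivity)]
    have := abs_real_inner_le_norm x m
    nlinarith [sq_nonneg (‖x‖ - 1), norm_nonneg m, norm_nonneg x, sq_nonneg ‖x‖,
      mul_nonneg (norm_nonneg m) (sq_nonneg (‖x‖ - 1)), mul_nonneg (norm_nonneg m) (sq_nonneg ‖x‖)]
  have h3 : ∀ (c : ℂ) (g : 𝓢(Rd d, ℂ)), (c • g).toLp 2 (volume : Measure (Rd d)) =
      c • g.toLp 2 (volume : Measure (Rd d)) := fun c g => (SchwartzMap.toLpCLM ℂ ℂ 2 (volume : Measure (Rd d))).map_smul c g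
  rw [h1, h3 (2 * Real.pi * Complex.I), norm_smul]
  have h4 : ‖(2 * Real.pi * Complex.I : ℂ)‖ = 2 * Real.pi := by
    simp [abs_of_pos Real.pi_pos]
  rw [h4, mul_assoc (2 * Real.pi)]
  exact mul_le_mul_of_nonneg_left h2 (by positivity)

theorem norm_toLp_laplacian_resolvent_le (f : 𝓢(Rd d, ℂ)) :
    ‖(Δ (laplaceResolvent d f)).toLp 2‖ ≤ (2 * Real.pi) ^ 2 * ‖f.toLp 2‖ := by
  have hm : (fun x : Rd d => ‖x‖ ^ 2).HasTemperateGrowth := by fun_prop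
  have h1 : Δ (laplaceResolvent d f) = (-(2 * Real.pi) ^ 2 : ℝ) •
      SchwartzMap.fourierMultiplierCLM ℂ ((fun x => ‖x‖ ^ 2) * resolventSymbol d) f := by
    rw [SchwartzMap.laplacian_eq_fourierMultiplierCLM, laplaceResolvent,
      SchwartzMap.fourierMultiplierCLM_fourierMultiplierCLM_apply hm
        hasTemperateGrowth_resolventSymbol]
  have h2 : ‖(SchwartzMap.fourierMultiplierCLM ℂ
      ((fun x => ‖x‖ ^ 2) * resolventSymbol d) f).toLp 2‖ ≤ 1 * ‖f.toLp 2‖ := by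
    refine norm_toLp_fourierMultiplierCLM_le (hm.mul hasTemperateGrowth_resolventSymbol)
      (fun x => ?_) f
    rw [Pi.mul_apply, resolventSymbol_eq, abs_of_nonneg (by positivity), ← div_eq_mul_inv,
      div_le_iff₀ (by positivity)]
    linarith
  have h3 : ∀ (c : ℝ) (g : 𝓢(Rd d, ℂ)), (c • g).toLp 2 (volume : Measure (Rd d)) =
      c • g.toLp 2 (volume : Measure (Rd d)) := fun c g => (SchwartzMap.toLpCLM ℝ ℂ 2 (volume : Measure (Rd d))).map_smul c g
  rw [h1, h3 (-(2 * Real.pi) ^ 2), norm_smul]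
  have h4 : ‖(-(2 * Real.pi) ^ 2 : ℝ)‖ = (2 * Real.pi) ^ 2 := by
    rw [norm_neg, Real.norm_of_nonneg (by positivity)]
  rw [h4]
  simpa using mul_le_mul_of_nonneg_left h2 (by positivity : (0 : ℝ) ≤ (2 * Real.pi) ^ 2)

/-- This links the Bessel potential defining `MemH2` to the concrete operator `laplaceResolvent`, so
that an `H²` function can be approximated by resolvents of Schwartz functions. -/
theorem besselPotential_neg_two_schwartz (f : 𝓢(Rd d, ℂ)) :
    TemperedDistribution.besselPotential (Rd d) ℂ (-2)
      (f.toLp 2 (volume : Measure (Rd d)) : 𝓢'(Rd d, ℂ)) =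
    ((laplaceResolvent d f).toLp 2 (volume : Measure (Rd d)) : 𝓢'(Rd d, ℂ)) := by
  have h := Function.hasTemperateGrowth_one_add_norm_sq_rpow (Rd d) (-2 / 2)
  rw [TemperedDistribution.besselPotential, Lp.toTemperedDistribution_toLp_eq,
    TemperedDistribution.fourierMultiplierCLM_toTemperedDistributionCLM_eq (by fun_prop),
    Lp.toTemperedDistribution_toLp_eq]
  congr 1
  have := SchwartzMap.fourierMultiplierCLM_ofReal (F := ℂ) ℂ h f
  refine this.trans ?_
  rw [laplaceResolvent]
  congr 2
  ext x
  norm_num [resolventSymbol]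

end Multipliers

/-! ### Density of Schwartz functions in `H²` and continuity of weighted norms. -/

section Approximation

open Filter Topology

variable {d : ℕ}

theorem cauchySeq_toLp_of_bounded {T : 𝓢(Rd d, ℂ) → 𝓢(Rd d, ℂ)}
    (hsub : ∀ f g, T (f - g) = T f - T g) {C : ℝ}
    (hT : ∀ f, ‖(T f).toLp 2 (volume : Measure (Rd d))‖ ≤ C * ‖f.toLp 2 (volume : Measure (Rd d))‖)
    {g : ℕ → 𝓢(Rd d, ℂ)} (hg : CauchySeq fun n => (g n).toLp 2 (volume : Measure (Rd d))) :
    CauchySeq fun n => (T (g n)).toLp 2 (volume : Measure (Rd d)) := by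
  have hs : ∀ f g : 𝓢(Rd d, ℂ), (f - g).toLp 2 (volume : Measure (Rd d)) =
      f.toLp 2 (volume : Measure (Rd d)) - g.toLp 2 (volume : Measure (Rd d)) := fun f g =>
      (SchwartzMap.toLpCLM ℂ ℂ 2 (volume : Measure (Rd d))).map_sub f g
  rw [Metric.cauchySeq_iff'] at hg ⊢
  intro ε hε
  obtain ⟨N, hN⟩ := hg (ε / (|C| + 1)) (by positivity)
  refine ⟨N, fun n hn => ?_⟩
  have h1 := hN n hn
  rw [dist_eq_norm] at h1 ⊢
  rw [← hs (g n) (g N)] at h1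
  rw [lt_div_iff₀ (by positivity)] at h1
  rw [← hs (T (g n)) (T (g N)), ← hsub]
  calc _ ≤ C * ‖(g n - g N).toLp 2 (volume : Measure (Rd d))‖ := hT _
    _ ≤ ‖(g n - g N).toLp 2 (volume : Measure (Rd d))‖ * (|C| + 1) := by
      rw [mul_comm]
      exact mul_le_mul_of_nonneg_left ((le_abs_self C).trans (by linarith)) (norm_nonneg _)
    _ < ε := h1

theorem toTemperedDistribution_injective :
    Function.Injective fun u : L2 d => (u : 𝓢'(Rd d, ℂ)) := by
  have := Lp.ker_toTemperedDistributionCLM_eq_bot (E := Rd d) (F := ℂ)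
    (μ := (volume : Measure (Rd d))) (p := 2)
  exact LinearMap.ker_eq_bot.1 this

theorem tendsto_toTemperedDistribution {u : ℕ → L2 d} {v : L2 d} (h : Tendsto u atTop (𝓝 v)) :
    Tendsto (fun n => (u n : 𝓢'(Rd d, ℂ))) atTop (𝓝 (v : 𝓢'(Rd d, ℂ))) :=
  ((Lp.toTemperedDistributionCLM ℂ (volume : Measure (Rd d)) 2).continuous.tendsto v).comp h

/-- Schwartz functions are dense in `H²`, simultaneously for the function, its gradient and its
Laplacian. -/
theorem exists_schwartz_approx {u : L2 d} (hu : MemH2 u) :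
    ∃ (φ : ℕ → 𝓢(Rd d, ℂ)) (G : Fin d → L2 d) (F : L2 d),
      Tendsto (fun n => (φ n).toLp 2 (volume : Measure (Rd d))) atTop (𝓝 u) ∧
      (∀ i, Tendsto (fun n => (∂_{EuclideanSpace.single i (1 : ℝ)} (φ n)).toLp 2
        (volume : Measure (Rd d))) atTop (𝓝 (G i))) ∧
      Tendsto (fun n => (Δ (φ n)).toLp 2 (volume : Measure (Rd d))) atTop (𝓝 F) ∧
      IsWeakGradient u G ∧ Δ (u : 𝓢'(Rd d, ℂ)) = (F : 𝓢'(Rd d, ℂ)) := by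
  -- Here `u` is the resolvent of `g ∈ L²`. Approximating `g` by Schwartz functions `γ n` and
  -- applying the resolvent, its derivatives and its Laplacian, all bounded on `L²`, gives the three
  -- limits at once.
  obtain ⟨g, hg⟩ := hu
  have hd : DenseRange (SchwartzMap.toLpCLM ℂ ℂ 2 (volume : Measure (Rd d))) :=
    SchwartzMap.denseRange_toLpCLM ENNReal.ofNat_ne_top
  obtain ⟨x, hx, hxg⟩ := mem_closure_iff_seq_limit.1 (hd g)
  choose γ hγ using hx
  have hγg : Tendsto (fun n => (γ n).toLp 2 (volume : Measure (Rd d))) atTop (𝓝 g) := by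
    exact hxg.congr fun n => (hγ n).symm
  have hc := hγg.cauchySeq
  obtain ⟨u', hu'⟩ := cauchySeq_tendsto_of_complete
    (cauchySeq_toLp_of_bounded (T := laplaceResolvent d) (by simp) norm_toLp_resolvent_le hc)
  choose G hG using fun i : Fin d => cauchySeq_tendsto_of_complete
    (cauchySeq_toLp_of_bounded
      (T := fun f => ∂_{EuclideanSpace.single i (1 : ℝ)} (laplaceResolvent d f))
      (fun f g => by
        rw [map_sub]
        exact (LineDeriv.lineDerivOpCLM ℝ 𝓢(Rd d, ℂ) (EuclideanSpace.single i (1 : ℝ))).map_sub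
          _ _)
      (norm_toLp_lineDeriv_resolvent_le _) hc)
  obtain ⟨F, hF⟩ := cauchySeq_tendsto_of_complete
    (cauchySeq_toLp_of_bounded (T := fun f => Δ (laplaceResolvent d f))
      (fun f g => by
        rw [map_sub]
        exact (LineDeriv.laplacianCLM ℝ (Rd d) 𝓢(Rd d, ℂ)).map_sub _ _)
      norm_toLp_laplacian_resolvent_le hc)
  have hdu' := tendsto_toTemperedDistribution hu'
  have huu' : u' = u := by
    refine toTemperedDistribution_injective ?_
    have h1 : TemperedDistribution.besselPotential (Rd d) ℂ (-2) (g : 𝓢'(Rd d, ℂ)) =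
        (u : 𝓢'(Rd d, ℂ)) := by
      rw [TemperedDistribution.besselPotential_neg_apply_eq_iff]
      exact hg
    have h2 := ((TemperedDistribution.besselPotential (Rd d) ℂ (-2)).continuous.tendsto _).comp
      (tendsto_toTemperedDistribution hγg)
    simp only [Function.comp_def, besselPotential_neg_two_schwartz, h1] at h2
    exact tendsto_nhds_unique hdu' h2
  subst huu'
  refine ⟨fun n => laplaceResolvent d (γ n), G, F, hu', hG, hF, fun i => ?_, ?_⟩
  · have h1 := tendsto_toTemperedDistribution (hG i)
    have h2 := ((LineDeriv.lineDerivOpCLM ℂ 𝓢'(Rd d, ℂ)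
      (EuclideanSpace.single i (1 : ℝ))).continuous.tendsto _).comp hdu'
    refine tendsto_nhds_unique h1 (h2.congr fun n => ?_)
    simp only [Function.comp_apply, LineDeriv.lineDerivOpCLM_apply,
      Lp.toTemperedDistribution_toLp_eq,
      TemperedDistribution.lineDerivOp_toTemperedDistributionCLM_eq]
  · have h1 := tendsto_toTemperedDistribution hF
    have h2 := ((LineDeriv.laplacianCLM ℂ (Rd d) 𝓢'(Rd d, ℂ)).continuous.tendsto _).comp hdu'
    rw [TemperedDistribution.laplacianCLM_apply] at h2
    refine tendsto_nhds_unique (h2.congr fun n => ?_) h1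
    simp only [Function.comp_apply, TemperedDistribution.laplacianCLM_apply,
      Lp.toTemperedDistribution_toLp_eq,
      TemperedDistribution.laplacian_toTemperedDistributionCLM_eq]

theorem integrable_norm_sq (u : L2 d) : Integrable fun x => ‖u x‖ ^ 2 :=
  (Lp.memLp u).integrable_norm_pow two_ne_zero

/-- Weighted `L²` norms depend continuously on the function. -/
theorem tendsto_integral_weight {w : Rd d → ℝ} (hw : IsBddWeight w) {u : ℕ → L2 d} {v : L2 d}
    (h : Tendsto u atTop (𝓝 v)) :
    Tendsto (fun n => ∫ x, w x * ‖u n x‖ ^ 2) atTop (𝓝 (∫ x, w x * ‖v x‖ ^ 2)) := by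
  obtain ⟨C, hC⟩ := hw.bounded
  have hm : MemLp (fun x => (w x : ℂ)) ⊤ (volume : Measure (Rd d)) :=
    memLp_top_of_bound (Complex.measurable_ofReal.comp hw.measurable).aestronglyMeasurable C
      (Eventually.of_forall fun x => by simpa using hC x)
  -- Multiplication by `w` is a bounded operator, so the weighted integral is the continuous form
  -- `Re ⟨u, Tu⟩`; the sign of `w` plays no role.
  let T : L2 d →L[ℂ] L2 d :=
    (ContinuousLinearMap.mul ℂ ℂ).holderL (volume : Measure (Rd d)) ⊤ 2 2 hm.toLp
  have hT : ∀ u : L2 d, ∫ x, w x * ‖u x‖ ^ 2 = (inner ℂ u (T u)).re := by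
    intro u
    have h1 : (inner ℂ u (T u) : ℂ) = ∫ x, ((w x * ‖u x‖ ^ 2 : ℝ) : ℂ) := by
      rw [L2.inner_def]
      refine integral_congr_ae ?_
      filter_upwards [(ContinuousLinearMap.mul ℂ ℂ).coeFn_holder (r := 2) hm.toLp u,
        hm.coeFn_toLp] with x hx1 hx2
      have : T u x = w x * u x := by
        simp only [T, ContinuousLinearMap.holderL_apply_apply]
        rw [hx1, hx2]
        simp
      rw [this]
      simp only [RCLike.inner_apply, Complex.ofReal_mul, Complex.ofReal_pow]
      rw [mul_assoc, Complex.mul_conj']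
    rw [h1, integral_complex_ofReal, Complex.ofReal_re]
  simp only [hT]
  have : Continuous fun u : L2 d => (inner ℂ u (T u)).re := by fun_prop
  exact (this.tendsto v).comp h

end Approximation

/-! ### From smooth real functions to complex `H²` functions. -/

section PassageToLimit

open Filter Topology

variable {d : ℕ}

theorem smooth_clm_comp_schwartz (l : ℂ →L[ℝ] ℝ) (φ : 𝓢(Rd d, ℂ)) : Smooth fun x => l (φ x) :=
  l.contDiff.comp (φ.smooth ⊤)

theorem pderiv_clm_comp_schwartz (l : ℂ →L[ℝ] ℝ) (φ : 𝓢(Rd d, ℂ)) (i : Fin d) :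
    pderiv i (fun x => l (φ x)) = fun x => l (∂_{EuclideanSpace.single i (1 : ℝ)} φ x) := by
  ext x
  have h : HasFDerivAt (fun x => l (φ x)) (l.comp (fderiv ℝ φ x)) x :=
    l.hasFDerivAt.comp x (φ.hasFDerivAt x)
  rw [pderiv_of_hasFDerivAt h, SchwartzMap.lineDerivOp_apply_eq_fderiv]
  rfl

theorem lap_clm_comp_schwartz (l : ℂ →L[ℝ] ℝ) (φ : 𝓢(Rd d, ℂ)) :
    lap (fun x => l (φ x)) = fun x => l (Δ φ x) := by
  ext x
  rw [SchwartzMap.laplacian_eq_sum (EuclideanSpace.basisFun (Fin d) ℝ), sum_apply, map_sum]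
  refine Finset.sum_congr rfl fun i _ => ?_
  rw [pderiv_clm_comp_schwartz, pderiv_clm_comp_schwartz]
  simp

theorem integrable_clm_comp_schwartz_sq (l : ℂ →L[ℝ] ℝ) (φ : 𝓢(Rd d, ℂ)) :
    Integrable fun x => l (φ x) ^ 2 :=
  (l.comp_memLp' (φ.memLp 2 volume)).integrable_sq

/-- The weights are real, so the form at `φ` is the sum of its values at the real and imaginary
parts. -/
theorem quadratic_nonneg_schwartz {w₀ w₁ w₂ : Rd d → ℝ} (h₀ : IsBddWeight w₀)
    (h₁ : IsBddWeight w₁) (h₂ : IsBddWeight w₂)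
    (hreal : ∀ p : Rd d → ℝ, Smooth p → Integrable (fun x => p x ^ 2) → Integrable (gradSq p) →
      Integrable (fun x => lap p x ^ 2) →
      0 ≤ ∫ x, w₀ x * p x ^ 2 + w₁ x * gradSq p x + w₂ x * lap p x ^ 2) (φ : 𝓢(Rd d, ℂ)) :
    0 ≤ ∫ x, w₀ x * ‖φ x‖ ^ 2 +
      w₁ x * ∑ i : Fin d, ‖(∂_{EuclideanSpace.single i (1 : ℝ)} φ : 𝓢(Rd d, ℂ)) x‖ ^ 2 +
      w₂ x * ‖Δ φ x‖ ^ 2 := by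
  have hl : ∀ l : ℂ →L[ℝ] ℝ,
      (Integrable fun x => w₀ x * l (φ x) ^ 2 + w₁ x * gradSq (fun x => l (φ x)) x +
        w₂ x * l (Δ φ x) ^ 2) ∧
      0 ≤ ∫ x, w₀ x * l (φ x) ^ 2 + w₁ x * gradSq (fun x => l (φ x)) x +
        w₂ x * l (Δ φ x) ^ 2 := by
    intro l
    have j0 := integrable_clm_comp_schwartz_sq l φ
    have j1 : Integrable (gradSq fun x => l (φ x)) := by
      refine integrable_finsetSum _ fun i _ => ?_
      rw [pderiv_clm_comp_schwartz]
      exact integrable_clm_comp_schwartz_sq l _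
    have j2 := integrable_clm_comp_schwartz_sq l (Δ φ)
    refine ⟨((h₀.integrable_mul j0).add (h₁.integrable_mul j1)).add (h₂.integrable_mul j2), ?_⟩
    have := hreal _ (smooth_clm_comp_schwartz l φ) j0 j1
      (by simpa only [lap_clm_comp_schwartz] using j2)
    simpa only [lap_clm_comp_schwartz] using this
  obtain ⟨ire, hre⟩ := hl Complex.reCLM
  obtain ⟨iim, him⟩ := hl Complex.imCLM
  refine (add_nonneg hre him).trans_eq ?_
  rw [← integral_add ire iim]
  refine integral_congr_ae (Eventually.of_forall fun x => ?_)
  have hsq : ∀ z : ℂ, ‖z‖ ^ 2 = z.re ^ 2 + z.im ^ 2 := fun z => by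
    rw [← Complex.normSq_eq_norm_sq, Complex.normSq_apply]; ring
  simp only [gradSq, pderiv_clm_comp_schwartz]
  simp only [hsq, Complex.reCLM_apply, Complex.imCLM_apply, Finset.sum_add_distrib]
  ring

theorem integral_quadratic_eq_sum {w₀ w₁ w₂ : Rd d → ℝ} (h₀ : IsBddWeight w₀)
    (h₁ : IsBddWeight w₁) (h₂ : IsBddWeight w₂) {v e : Rd d → ℝ} {g : Fin d → Rd d → ℝ}
    (hv : Integrable v) (hg : ∀ i, Integrable (g i)) (he : Integrable e) :
    ∫ x, w₀ x * v x + w₁ x * ∑ i, g i x + w₂ x * e x =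
      (∫ x, w₀ x * v x) + (∑ i, ∫ x, w₁ x * g i x) + ∫ x, w₂ x * e x := by
  have i0 := h₀.integrable_mul hv
  have i1 := fun i => h₁.integrable_mul (hg i)
  have i2 := h₂.integrable_mul he
  have i3 : Integrable fun x => ∑ i, w₁ x * g i x := integrable_finsetSum _ fun i _ => i1 i
  have i4 : Integrable fun x => w₀ x * v x + ∑ i, w₁ x * g i x := i0.add i3
  simp only [Finset.mul_sum]
  rw [integral_add i4 i2, integral_add i0 i3, integral_finsetSum _ fun i _ => i1 i]

theorem integral_weight_toLp (w : Rd d → ℝ) (φ : 𝓢(Rd d, ℂ)) :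
    ∫ x, w x * ‖φ.toLp 2 (volume : Measure (Rd d)) x‖ ^ 2 = ∫ x, w x * ‖φ x‖ ^ 2 := by
  refine integral_congr_ae ?_
  filter_upwards [SchwartzMap.coeFn_toLp φ 2 volume] with x hx
  rw [hx]

theorem integrable_norm_sq_schwartz (φ : 𝓢(Rd d, ℂ)) : Integrable fun x => ‖φ x‖ ^ 2 :=
  (φ.memLp 2 volume).integrable_norm_pow two_ne_zero

/-- A quadratic integral inequality for smooth real functions extends to `H²`. -/
theorem quadratic_nonneg_of_smooth {w₀ w₁ w₂ : Rd d → ℝ} (h₀ : IsBddWeight w₀)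
    (h₁ : IsBddWeight w₁) (h₂ : IsBddWeight w₂)
    (hreal : ∀ p : Rd d → ℝ, Smooth p → Integrable (fun x => p x ^ 2) → Integrable (gradSq p) →
      Integrable (fun x => lap p x ^ 2) →
      0 ≤ ∫ x, w₀ x * p x ^ 2 + w₁ x * gradSq p x + w₂ x * lap p x ^ 2)
    {u : L2 d} (hu : MemH2 u) {G : Fin d → L2 d} (hG : IsWeakGradient u G) {F : L2 d}
    (hF : Δ (u : 𝓢'(Rd d, ℂ)) = (F : 𝓢'(Rd d, ℂ))) :
    0 ≤ ∫ x, w₀ x * ‖u x‖ ^ 2 + w₁ x * ∑ i, ‖G i x‖ ^ 2 + w₂ x * ‖F x‖ ^ 2 := by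
  obtain ⟨φ, G', F', hφ, hφG, hφF, hG', hF'⟩ := exists_schwartz_approx hu
  -- An `L²` function is determined by its distribution, so the limits are the given gradient and
  -- Laplacian.
  obtain rfl : G' = G := funext fun i =>
    toTemperedDistribution_injective ((hG' i).trans (hG i).symm)
  obtain rfl : F' = F := toTemperedDistribution_injective (hF'.symm.trans hF)
  rw [integral_quadratic_eq_sum h₀ h₁ h₂ (integrable_norm_sq u)
    (fun i => integrable_norm_sq (G' i)) (integrable_norm_sq F')]
  have hlim := ((tendsto_integral_weight h₀ hφ).add
    (tendsto_finsetSum Finset.univ fun i _ => tendsto_integral_weight h₁ (hφG i))).add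
    (tendsto_integral_weight h₂ hφF)
  simp only [integral_weight_toLp] at hlim
  refine ge_of_tendsto' hlim fun n => ?_
  exact (quadratic_nonneg_schwartz h₀ h₁ h₂ hreal (φ n)).trans_eq
    (integral_quadratic_eq_sum h₀ h₁ h₂ (integrable_norm_sq_schwartz (φ n))
      (fun i => integrable_norm_sq_schwartz (∂_{EuclideanSpace.single i (1 : ℝ)} (φ n)))
      (integrable_norm_sq_schwartz (Δ (φ n))))

end PassageToLimit

/-! ### Estimates for functions with `|Δu| ≤ L|u|`. -/

section Elliptic

variable {d : ℕ}

/-- The squared length of the weak gradient. -/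
noncomputable def gradNormSq (G : Fin d → L2 d) (x : Rd d) : ℝ := ∑ i, ‖G i x‖ ^ 2

theorem gradNormSq_nonneg (G : Fin d → L2 d) (x : Rd d) : 0 ≤ gradNormSq G x :=
  Finset.sum_nonneg fun _ _ => sq_nonneg _

theorem integrable_gradNormSq (G : Fin d → L2 d) : Integrable (gradNormSq G) :=
  integrable_finsetSum _ fun i _ => integrable_norm_sq (G i)

theorem integral_indicator_one_mul {s : Set (Rd d)} (hs : MeasurableSet s) (g : Rd d → ℝ) :
    ∫ x, s.indicator (fun _ => (1 : ℝ)) x * g x = ∫ x in s, g x := by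
  rw [← integral_indicator hs]
  refine integral_congr_ae (Filter.Eventually.of_forall fun x => ?_)
  by_cases hx : x ∈ s <;> simp [hx]

/-- A solution of `Δ u + V u = 0` satisfies `|Δ u| ≤ L |u|`. -/
theorem SolvesElliptic.exists_laplacian {V : Rd d → ℂ} {u : L2 d} {L : ℝ}
    (h : SolvesElliptic V u) (hV : PotentialBound V L) :
    ∃ F : L2 d, Δ (u : 𝓢'(Rd d, ℂ)) = (F : 𝓢'(Rd d, ℂ)) ∧
      ∀ᵐ x, ‖F x‖ ^ 2 ≤ L ^ 2 * ‖u x‖ ^ 2 := by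
  obtain ⟨W, hW, hsol⟩ := h
  refine ⟨-W, ?_, ?_⟩
  · have : ((-W : L2 d) : 𝓢'(Rd d, ℂ)) = -(W : 𝓢'(Rd d, ℂ)) :=
      (Lp.toTemperedDistributionCLM ℂ (volume : Measure (Rd d)) 2).map_neg W
    rw [this]
    exact eq_neg_of_add_eq_zero_left hsol
  · filter_upwards [Lp.coeFn_neg W, hW, hV.2] with x h1 h2 h3
    rw [h1, Pi.neg_apply, norm_neg, h2, norm_mul, mul_pow]
    gcongr

variable {u F : L2 d} {G : Fin d → L2 d} {L : ℝ}

/-- Carleman estimate for functions with `|Δ u| ≤ L |u|`. -/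
theorem carleman_ball {K : ℝ} (i : Fin d)
    (hcut : ∀ r R : ℝ, 0 ≤ r → r < R → ∃ χ : Rd d → ℝ, IsCutoff K r R χ)
    (hu : MemH2 u) (hG : IsWeakGradient u G)
    (hF : Δ (u : 𝓢'(Rd d, ℂ)) = (F : 𝓢'(Rd d, ℂ)))
    (hFu : ∀ᵐ x, ‖F x‖ ^ 2 ≤ L ^ 2 * ‖u x‖ ^ 2) {r R τ : ℝ} (hr : 0 ≤ r) (hrR : r < R)
    (hK : 0 ≤ K) (hτ : 0 ≤ τ) (hL : L ^ 2 ≤ τ ^ 3 * R ^ 2) :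
    τ ^ 3 * R ^ 2 * ∫ x in {x : Rd d | ‖x‖ ≤ r}, ‖u x‖ ^ 2 ≤
      Real.exp (9 * τ * R ^ 2) * ((K / (R - r) ^ 2) ^ 2 * (∫ x in openRing d r R, ‖u x‖ ^ 2) +
        3 * (K / (R - r) ^ 2) * ∫ x in openRing d r R, gradNormSq G x) := by
  obtain ⟨χ, hχ⟩ := hcut r R hr hrR
  have hR : 0 < R := hr.trans_lt hrR
  set κ := K / (R - r) ^ 2 with hκ
  have hκ0 : 0 ≤ κ := by positivity
  set e := Real.exp (9 * τ * R ^ 2)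
  have he : 0 < e := Real.exp_pos _
  set I : Rd d → ℝ := (openRing d r R).indicator fun _ => (1 : ℝ) with hI
  set W : Rd d → ℝ := fun x => Real.exp (τ * affineCoord i (2 * R) x ^ 2) * χ x ^ 2 with hWdef
  have hIw : IsBddWeight I := .indicator_one (measurableSet_openRing r R)
  have hW : IsBddWeight W :=
    .of_continuous ((contDiff_const.mul ((smooth_affineCoord i (2 * R)).pow 2)).exp.mul
      (hχ.smooth.pow 2)).continuous (hasCompactSupport_sq hχ.hasCompactSupport).mul_left
  have hW0 : ∀ x, 0 ≤ W x := fun x => by positivity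
  have iu := integrable_norm_sq u
  have iG := integrable_gradNormSq G
  have hq := quadratic_nonneg_of_smooth
    (w₀ := fun x => 4 * κ ^ 2 * e * I x - 8 * τ ^ 3 * R ^ 2 * W x)
    (w₁ := fun x => 16 * κ * e * I x) (w₂ := fun x => 2 * W x)
    ((hIw.const_mul _).sub (hW.const_mul _)) (hIw.const_mul _) (hW.const_mul _)
    (fun p hp h0 h1 h2 => carleman_cutoff i hR hτ hχ hp h0 h1 h2) hu hG hF
  have hbound : ∫ x, (4 * κ ^ 2 * e * I x - 8 * τ ^ 3 * R ^ 2 * W x) * ‖u x‖ ^ 2 +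
        (16 * κ * e * I x) * ∑ i, ‖G i x‖ ^ 2 + (2 * W x) * ‖F x‖ ^ 2 ≤
      ∫ x, 4 * κ ^ 2 * e * (I x * ‖u x‖ ^ 2) + 16 * κ * e * (I x * gradNormSq G x) -
        6 * τ ^ 3 * R ^ 2 * (W x * ‖u x‖ ^ 2) := by
    refine integral_mono_ae ?_ ?_ ?_
    · exact ((((hIw.const_mul _).sub (hW.const_mul _)).integrable_mul iu).add
        ((hIw.const_mul _).integrable_mul iG)).add
        ((hW.const_mul _).integrable_mul (integrable_norm_sq F))
    · exact (((hIw.integrable_mul iu).const_mul _).add ((hIw.integrable_mul iG).const_mul _)).sub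
        ((hW.integrable_mul iu).const_mul _)
    · filter_upwards [hFu] with x hx
      -- Absorption: `2W|F|²` uses up `2` of the `8` units of `τ³R² W|u|²` and leaves `6`.
      have h1 : W x * ‖F x‖ ^ 2 ≤ W x * (τ ^ 3 * R ^ 2 * ‖u x‖ ^ 2) :=
        mul_le_mul_of_nonneg_left (hx.trans (mul_le_mul_of_nonneg_right hL (sq_nonneg _))) (hW0 x)
      simp only [gradNormSq]
      linarith
  have hsplit := hq.trans hbound
  have ia : Integrable fun x => 4 * κ ^ 2 * e * (I x * ‖u x‖ ^ 2) :=
    (hIw.integrable_mul iu).const_mul _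
  have ib : Integrable fun x => 16 * κ * e * (I x * gradNormSq G x) :=
    (hIw.integrable_mul iG).const_mul _
  have iab : Integrable fun x => 4 * κ ^ 2 * e * (I x * ‖u x‖ ^ 2) +
    16 * κ * e * (I x * gradNormSq G x) := ia.add ib
  rw [integral_sub iab ((hW.integrable_mul iu).const_mul _), integral_add ia ib,
    integral_const_mul, integral_const_mul, integral_const_mul,
    integral_indicator_one_mul (measurableSet_openRing r R),
    integral_indicator_one_mul (measurableSet_openRing r R)] at hsplit
  have hball : ∫ x in {x : Rd d | ‖x‖ ≤ r}, ‖u x‖ ^ 2 ≤ ∫ x, W x * ‖u x‖ ^ 2 := by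
    have hs : MeasurableSet {x : Rd d | ‖x‖ ≤ r} := measurableSet_le measurable_norm measurable_const
    rw [← integral_indicator_one_mul hs]
    refine integral_mono ((IsBddWeight.indicator_one hs).integrable_mul iu)
      (hW.integrable_mul iu) fun x => ?_
    refine mul_le_mul_of_nonneg_right ?_ (sq_nonneg _)
    by_cases hx : ‖x‖ ≤ r
    · rw [Set.indicator_of_mem (by exact hx)]
      simp only [hWdef, hχ.eq_one x hx]
      simpa using Real.one_le_exp (by positivity : 0 ≤ τ * affineCoord i (2 * R) x ^ 2)
    · rw [Set.indicator_of_notMem (by exact hx)]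
      exact hW0 x
  have hU : 0 ≤ ∫ x in openRing d r R, ‖u x‖ ^ 2 := integral_nonneg fun x => sq_nonneg _
  have hGn : 0 ≤ ∫ x in openRing d r R, gradNormSq G x :=
    integral_nonneg fun x => gradNormSq_nonneg G x
  have h1 := mul_le_mul_of_nonneg_left hball (by positivity : 0 ≤ τ ^ 3 * R ^ 2)
  have h2 : 0 ≤ e * κ ^ 2 * ∫ x in openRing d r R, ‖u x‖ ^ 2 := by positivity
  have h3 : 0 ≤ e * κ * ∫ x in openRing d r R, gradNormSq G x := by positivity
  -- Division by `6`, with `4/6 ≤ 1` and `16/6 ≤ 3`.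
  nlinarith

theorem lap_sub {f g : Rd d → ℝ} (hf : Smooth f) (hg : Smooth g) (x : Rd d) :
    lap (fun x => f x - g x) x = lap f x - lap g x := by
  simp only [lap, ← Finset.sum_sub_distrib]
  refine Finset.sum_congr rfl fun i _ => ?_
  rw [pderiv_sub hf hg, pderiv_sub (smooth_pderiv hf i) (smooth_pderiv hg i)]

/-- The gradient of a function with `|Δ u| ≤ L |u|` on a ring is controlled by the function on a
larger set. -/
theorem caccioppoli_ring {K : ℝ}
    (hcut : ∀ r R : ℝ, 0 ≤ r → r < R → ∃ χ : Rd d → ℝ, IsCutoff K r R χ)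
    (hu : MemH2 u) (hG : IsWeakGradient u G)
    (hF : Δ (u : 𝓢'(Rd d, ℂ)) = (F : 𝓢'(Rd d, ℂ)))
    (hFu : ∀ᵐ x, ‖F x‖ ^ 2 ≤ L ^ 2 * ‖u x‖ ^ 2) {s r R ε : ℝ} (hs : 0 ≤ s) (hsr : s < r)
    (hrR : r < R) (hK : 0 ≤ K) (hε : 0 < ε) :
    2 * ∫ x in openRing d r R, gradNormSq G x ≤
      (K / (r - s) ^ 2 + K / R ^ 2 + ε + ε⁻¹ * L ^ 2) *
        ∫ x in {x : Rd d | s < ‖x‖}, ‖u x‖ ^ 2 := by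
  have hR : 0 < R := (hs.trans_lt hsr).trans hrR
  obtain ⟨χ, hχ⟩ := hcut s r hs hsr
  obtain ⟨ψ, hψ⟩ := hcut R (2 * R) hR.le (by linarith)
  set κ := K / (r - s) ^ 2 + K / R ^ 2 with hκ
  have hκ0 : 0 ≤ κ := by positivity
  -- `ξ` equals `1` on the ring `(r, R)` and vanishes for `|x| ≤ s` and `|x| ≥ 2R`.
  set ξ : Rd d → ℝ := fun x => ψ x - χ x with hξ
  have hsξ : Smooth ξ := hψ.smooth.sub hχ.smooth
  have hcξ : HasCompactSupport ξ := hψ.hasCompactSupport.sub hχ.hasCompactSupport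
  have hξ0 : ∀ x, 0 ≤ ξ x := by
    intro x
    by_cases hx : ‖x‖ ≤ R
    · have := hχ.le_one x
      simp only [hξ, hψ.eq_one x hx]; linarith
    · have := hψ.nonneg x
      simp only [hξ, hχ.eq_zero x (by linarith)]; linarith
  have hms : MeasurableSet {x : Rd d | s < ‖x‖} := measurableSet_lt measurable_const measurable_norm
  set J : Rd d → ℝ := {x : Rd d | s < ‖x‖}.indicator fun _ => (1 : ℝ) with hJ
  set I : Rd d → ℝ := (openRing d r R).indicator fun _ => (1 : ℝ) with hI
  have hIw : IsBddWeight I := .indicator_one (measurableSet_openRing r R)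
  have hJw : IsBddWeight J := .indicator_one hms
  have hξw : IsBddWeight ξ := .of_continuous hsξ.continuous hcξ
  have hlw : IsBddWeight (lap ξ) :=
    .of_continuous (smooth_lap hsξ).continuous (hasCompactSupport_lap hcξ)
  have hξJ : ∀ x, ξ x ≤ J x := by
    intro x
    by_cases hx : s < ‖x‖
    · have h1 := hψ.le_one x
      have h2 := hχ.nonneg x
      simp only [hJ, Set.indicator_of_mem (show x ∈ {x : Rd d | s < ‖x‖} from hx), hξ]
      linarith
    · have hx' := not_lt.1 hx
      simp only [hξ, hχ.eq_one x hx', hψ.eq_one x (by linarith)]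
      rw [hJ, Set.indicator_of_notMem (by exact hx)]
      simp
  have hIξ : ∀ x, I x ≤ ξ x := by
    intro x
    by_cases hx : x ∈ openRing d r R
    · simp only [hI, Set.indicator_of_mem hx, hξ, hψ.eq_one x hx.2.le, hχ.eq_zero x hx.1.le]
      simp
    · simp only [hI, Set.indicator_of_notMem hx]
      exact hξ0 x
  have hlJ : ∀ x, |lap ξ x| ≤ κ * J x := by
    intro x
    rw [hξ, lap_sub hψ.smooth hχ.smooth]
    by_cases hx : s < ‖x‖
    · have h1 := hψ.lap_le x
      have h2 := hχ.lap_le x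
      rw [hJ, Set.indicator_of_mem (by exact hx), mul_one, hκ]
      rw [show 2 * R - R = R by ring] at h1
      linarith [abs_sub (lap ψ x) (lap χ x)]
    · have hx' := not_lt.1 hx
      rw [hψ.lap_eq_zero x fun h => by linarith [h.1], hχ.lap_eq_zero x fun h => hx h.1, hJ,
        Set.indicator_of_notMem (by exact hx)]
      simp
  have iu := integrable_norm_sq u
  have iG := integrable_gradNormSq G
  have hq := quadratic_nonneg_of_smooth (w₀ := fun x => |lap ξ x| + ε * ξ x)
    (w₁ := fun x => -2 * ξ x) (w₂ := fun x => ε⁻¹ * ξ x)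
    (hlw.abs.add (hξw.const_mul _)) (hξw.const_mul _) (hξw.const_mul _)
    (fun p hp _ _ _ => caccioppoli hsξ hcξ hξ0 hε hp) hu hG hF
  have hbound : ∫ x, (|lap ξ x| + ε * ξ x) * ‖u x‖ ^ 2 + (-2 * ξ x) * ∑ i, ‖G i x‖ ^ 2 +
        (ε⁻¹ * ξ x) * ‖F x‖ ^ 2 ≤
      ∫ x, (κ + ε + ε⁻¹ * L ^ 2) * (J x * ‖u x‖ ^ 2) - 2 * (I x * gradNormSq G x) := by
    refine integral_mono_ae ?_ ?_ ?_
    · exact (((hlw.abs.add (hξw.const_mul _)).integrable_mul iu).add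
        ((hξw.const_mul _).integrable_mul iG)).add
        ((hξw.const_mul _).integrable_mul (integrable_norm_sq F))
    · exact ((hJw.integrable_mul iu).const_mul _).sub ((hIw.integrable_mul iG).const_mul _)
    · filter_upwards [hFu] with x hx
      have h1 := mul_le_mul_of_nonneg_right (hlJ x) (sq_nonneg ‖u x‖)
      have h2 := mul_le_mul_of_nonneg_right (hξJ x)
        (by positivity : 0 ≤ (ε + ε⁻¹ * L ^ 2) * ‖u x‖ ^ 2)
      have h3 := mul_le_mul_of_nonneg_right (hIξ x) (gradNormSq_nonneg G x)
      have h4 := mul_le_mul_of_nonneg_left hx (mul_nonneg (inv_nonneg.2 hε.le) (hξ0 x))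
      simp only [gradNormSq] at h3 ⊢
      linarith
  have hsplit := hq.trans hbound
  rw [integral_sub ((hJw.integrable_mul iu).const_mul _) ((hIw.integrable_mul iG).const_mul _),
    integral_const_mul, integral_const_mul, integral_indicator_one_mul hms,
    integral_indicator_one_mul (measurableSet_openRing r R)] at hsplit
  linarith

end Elliptic

/-! ### Part (i): the lower bound on rings of width one. -/

section QuantitativeLowerBound

variable {d : ℕ}

theorem measurableSet_norm_le (r : ℝ) : MeasurableSet {x : Rd d | ‖x‖ ≤ r} :=
  measurableSet_le measurable_norm measurable_const

theorem measurableSet_lt_norm (r : ℝ) : MeasurableSet {x : Rd d | r < ‖x‖} :=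
  measurableSet_lt measurable_const measurable_norm

/-- The smallest `τ` permitted by the absorption condition; `τR²` is then the exponent of the
Carleman loss. -/
theorem exists_scale {Λ R : ℝ} (hΛ : 0 ≤ Λ) (hR : 0 < R) :
    ∃ τ : ℝ, 0 ≤ τ ∧ τ ^ 3 * R ^ 2 = Λ ^ 2 ∧ τ * R ^ 2 = Λ ^ (2 / 3 : ℝ) * R ^ (4 / 3 : ℝ) := by
  refine ⟨Λ ^ (2 / 3 : ℝ) * R ^ (-(2 / 3) : ℝ), by positivity, ?_, ?_⟩
  · rw [mul_pow, ← Real.rpow_natCast, ← Real.rpow_natCast (R ^ (-(2 / 3) : ℝ)),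
      ← Real.rpow_mul hΛ, ← Real.rpow_mul hR.le, mul_assoc, ← Real.rpow_natCast R 2,
      ← Real.rpow_add hR]
    norm_num
  · rw [mul_assoc, ← Real.rpow_natCast R 2, ← Real.rpow_add hR]
    norm_num

/-- A single `c` must serve as both prefactor and rate. Since `c ≥ 9η` and `X ≥ 1`, a factor
`e^{-c}` is left over, and `c ≥ 6D` gives `Dc² ≤ c³/6 ≤ e^c`. -/
theorem exists_exp_rate {D η : ℝ} (hD : 1 ≤ D) (hη : 0 ≤ η) :
    ∃ c : ℝ, 0 < c ∧ ∀ X y : ℝ, 1 ≤ X → 0 ≤ y → 1 ≤ D * Real.exp (9 * η * X) * y ^ 2 →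
      c * Real.exp (-c * X) ≤ y := by
  refine ⟨9 * η + 6 * D, by positivity, fun X y hX hy h => ?_⟩
  set c := 9 * η + 6 * D with hc
  have hc0 : 0 < c := by positivity
  refine le_of_sq_le_sq ?_ hy
  have hE : 0 < D * Real.exp (9 * η * X) := by positivity
  suffices hs : D * Real.exp (9 * η * X) * (c * Real.exp (-c * X)) ^ 2 ≤ 1 by
    exact le_of_mul_le_mul_left (hs.trans h) hE
  have h1 : Real.exp (9 * η * X) * Real.exp (-c * X) ^ 2 ≤ Real.exp (-c) := by
    rw [sq, ← Real.exp_add, ← Real.exp_add]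
    refine Real.exp_le_exp.2 ?_
    have : 0 ≤ D * X := by positivity
    nlinarith
  have h2 : c ^ 3 / 6 ≤ Real.exp c := by
    have := Real.pow_div_factorial_le_exp c hc0.le 3
    norm_num [Nat.factorial] at this
    exact this
  have h3 : c ^ 3 / 6 * Real.exp (-c) ≤ 1 := by
    calc c ^ 3 / 6 * Real.exp (-c) ≤ Real.exp c * Real.exp (-c) := by gcongr
      _ = 1 := by rw [← Real.exp_add]; simp
  have h4 : D * c ^ 2 ≤ c ^ 3 / 6 := by
    have : 6 * D ≤ c := by linarith
    nlinarith [mul_le_mul_of_nonneg_right this (sq_nonneg c)]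
  calc D * Real.exp (9 * η * X) * (c * Real.exp (-c * X)) ^ 2
      = D * c ^ 2 * (Real.exp (9 * η * X) * Real.exp (-c * X) ^ 2) := by ring
    _ ≤ D * c ^ 2 * Real.exp (-c) := by gcongr
    _ ≤ c ^ 3 / 6 * Real.exp (-c) := by gcongr
    _ ≤ 1 := h3

theorem sq_ringNorm (u : L2 d) (G : Fin d → L2 d) (R : ℝ) :
    ringNorm u G R ^ 2 = (∫ x in openRing d (R - 1) R, ‖u x‖ ^ 2) +
      ∫ x in openRing d (R - 1) R, gradNormSq G x := by
  rw [ringNorm, Real.sq_sqrt (integral_nonneg fun x => by unfold energyDensity; positivity),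
    ← integral_add (integrable_norm_sq u).integrableOn (integrable_gradNormSq G).integrableOn]
  rfl

/-- Quantitative lower bound for the `H¹` norm of a solution on rings of width one. -/
theorem exists_ringNorm_lower_bound (hd : 1 ≤ d) (L : ℝ) : ∃ c : ℝ, 0 < c ∧
    ∀ (V : Rd d → ℂ) (u : L2 d) (G : Fin d → L2 d),
      MemH2 u → IsWeakGradient u G → SolvesElliptic V u → PotentialBound V L →
      1 ≤ (∫ x in {x : Rd d | ‖x‖ < 1}, ‖u x‖ ^ 2) →
      ∀ R : ℝ, 1 ≤ R → c * Real.exp (-c * R ^ (4 / 3 : ℝ)) ≤ ringNorm u G R := by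
  obtain ⟨K, hK, hcut⟩ := exists_isCutoff d
  -- With `Λ ≥ 1` the factor `τ³R² = Λ²` on the left of the Carleman estimate can be dropped.
  set Λ := max L 1 with hΛ
  have hΛ1 : 1 ≤ Λ := le_max_right _ _
  have hΛ0 : 0 ≤ Λ := zero_le_one.trans hΛ1
  obtain ⟨c, hc, hexp⟩ := exists_exp_rate (D := K ^ 2 + 3 * K + 1) (η := Λ ^ (2 / 3 : ℝ))
    (by nlinarith) (by positivity)
  refine ⟨c, hc, fun V u G hu hG hsol hV h1 R hR => ?_⟩
  have hV' : PotentialBound V Λ := ⟨hV.1, hV.2.mono fun x hx => hx.trans (le_max_left _ _)⟩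
  obtain ⟨F, hF, hFu⟩ := hsol.exists_laplacian hV'
  have hR0 : 0 < R := by linarith
  obtain ⟨τ, hτ, hτ3, hτ1⟩ := exists_scale hΛ0 hR0
  have hcar := carleman_ball ⟨0, hd⟩ hcut hu hG hF hFu (r := R - 1) (R := R) (by linarith)
    (by linarith) hK hτ hτ3.ge
  rw [hτ3, mul_assoc 9, hτ1, ← mul_assoc, sub_sub_cancel, one_pow, div_one] at hcar
  refine hexp _ _ (Real.one_le_rpow hR (by norm_num)) (Real.sqrt_nonneg _) ?_
  set E := Real.exp (9 * Λ ^ (2 / 3 : ℝ) * R ^ (4 / 3 : ℝ))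
  have hE : 1 ≤ E := Real.one_le_exp (by positivity)
  have iu := integrable_norm_sq u
  have hU : 0 ≤ ∫ x in openRing d (R - 1) R, ‖u x‖ ^ 2 := integral_nonneg fun x => sq_nonneg _
  have hGn : 0 ≤ ∫ x in openRing d (R - 1) R, gradNormSq G x :=
    integral_nonneg fun x => gradNormSq_nonneg G x
  have hB : 0 ≤ ∫ x in {x : Rd d | ‖x‖ ≤ R - 1}, ‖u x‖ ^ 2 := integral_nonneg fun x => sq_nonneg _
  -- For `R < 2` the inner ball is smaller than the unit ball; the ring contains the rest because `R
  -- ≥ 1`.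
  have hcover : ∫ x in {x : Rd d | ‖x‖ < 1}, ‖u x‖ ^ 2 ≤
      (∫ x in {x : Rd d | ‖x‖ ≤ R - 1}, ‖u x‖ ^ 2) + ∫ x in openRing d (R - 1) R, ‖u x‖ ^ 2 := by
    have hdisj : Disjoint {x : Rd d | ‖x‖ ≤ R - 1} (openRing d (R - 1) R) :=
      Set.disjoint_left.2 fun x hx hx' => not_lt.2 hx hx'.1
    rw [← setIntegral_union hdisj
      (measurableSet_openRing _ _) iu.integrableOn iu.integrableOn]
    refine setIntegral_mono_set iu.integrableOn
      (Filter.Eventually.of_forall fun x => sq_nonneg _) (Filter.Eventually.of_forall ?_)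
    intro x (hx : ‖x‖ < 1)
    by_cases h : ‖x‖ ≤ R - 1
    · exact Or.inl h
    · exact Or.inr ⟨not_le.1 h, hx.trans_le hR⟩
  rw [sq_ringNorm]
  have hΛB : (∫ x in {x : Rd d | ‖x‖ ≤ R - 1}, ‖u x‖ ^ 2) ≤
      Λ ^ 2 * ∫ x in {x : Rd d | ‖x‖ ≤ R - 1}, ‖u x‖ ^ 2 :=
    le_mul_of_one_le_left hB (by nlinarith)
  set U := ∫ x in openRing d (R - 1) R, ‖u x‖ ^ 2
  set N := ∫ x in openRing d (R - 1) R, gradNormSq G x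
  have h2 : 1 ≤ E * (K ^ 2 * U + 3 * K * N) + U := by linarith
  refine h2.trans ?_
  have h3 : U ≤ E * (U + N) := by nlinarith
  have h4 : 0 ≤ K ^ 2 * N + 3 * K * U := by positivity
  nlinarith [mul_le_mul_of_nonneg_left h4 (zero_le_one.trans hE)]

end QuantitativeLowerBound

/-! ### Part (ii): fast decay forces vanishing. -/

section UniqueContinuation

open Filter Topology

variable {d : ℕ}

theorem tendsto_setIntegral_lt_norm {h : Rd d → ℝ} (hh : Integrable h) :
    Tendsto (fun n : ℕ => ∫ x in {x : Rd d | (n : ℝ) / 2 < ‖x‖}, h x) atTop (𝓝 0) := by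
  have hanti : Antitone fun n : ℕ => {x : Rd d | (n : ℝ) / 2 < ‖x‖} := by
    intro m n hmn x hx
    have : (m : ℝ) ≤ n := by exact_mod_cast hmn
    exact lt_of_le_of_lt (by linarith) (show (n : ℝ) / 2 < ‖x‖ from hx)
  have := hanti.tendsto_setIntegral (fun n => measurableSet_lt_norm _) (hh.integrableOn)
  have hempty : ⋂ n : ℕ, {x : Rd d | (n : ℝ) / 2 < ‖x‖} = ∅ := by
    ext x
    simp only [Set.mem_iInter, Set.mem_ofPred_eq, Set.mem_empty_iff_false, iff_false, not_forall,
      not_lt]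
    obtain ⟨n, hn⟩ := exists_nat_ge (2 * ‖x‖)
    exact ⟨n, by linarith⟩
  rwa [hempty, setIntegral_empty] at this

/-- The mass of a solution in a ball is controlled by its mass far away. -/
theorem exists_ball_le_exterior (hd : 1 ≤ d) : ∃ C : ℝ, 0 ≤ C ∧
    ∀ (L : ℝ), 0 ≤ L → ∀ (V : Rd d → ℂ) (u : L2 d),
      MemH2 u → SolvesElliptic V u → PotentialBound V L →
      ∀ R τ : ℝ, 0 < R → 0 ≤ τ → L ^ 2 ≤ τ ^ 3 * R ^ 2 →
      τ ^ 3 * R ^ 2 * ∫ x in {x : Rd d | ‖x‖ ≤ 3 / 4 * R}, ‖u x‖ ^ 2 ≤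
        C * (R⁻¹ ^ 4 + L * R⁻¹ ^ 2) *
          (Real.exp (9 * (τ * R ^ 2)) * ∫ x in {x : Rd d | R / 2 < ‖x‖}, ‖u x‖ ^ 2) := by
  obtain ⟨K, hK, hcut⟩ := exists_isCutoff d
  refine ⟨1072 * K ^ 2 + 96 * K, by positivity, fun L hL V u hu hsol hV R τ hR hτ hLτ => ?_⟩
  obtain ⟨F, hF, hFu⟩ := hsol.exists_laplacian hV
  -- Only the existence of a weak gradient is taken from the approximation here.
  obtain ⟨_, G, _, _, _, _, hG, _⟩ := exists_schwartz_approx hu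
  have hcar := carleman_ball ⟨0, hd⟩ hcut hu hG hF hFu (r := 3 / 4 * R) (R := R) (by linarith)
    (by linarith) hK hτ hLτ
  -- The choice `ε = R⁻² + L` makes `ε + ε⁻¹L² ≤ R⁻² + 2L` and remains positive when `L = 0`.
  have hε : 0 < R⁻¹ ^ 2 + L := by positivity
  have hcac := caccioppoli_ring hcut hu hG hF hFu (s := R / 2) (r := 3 / 4 * R) (R := R)
    (by linarith) (by linarith) (by linarith) hK hε
  have hεL : (R⁻¹ ^ 2 + L)⁻¹ * L ^ 2 ≤ L := by
    rw [inv_mul_le_iff₀ hε]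
    nlinarith [mul_nonneg hL (sq_nonneg R⁻¹)]
  have hw1 : K / (R - 3 / 4 * R) ^ 2 = 16 * K * R⁻¹ ^ 2 := by field_simp; norm_num
  have hw2 : K / (3 / 4 * R - R / 2) ^ 2 = 16 * K * R⁻¹ ^ 2 := by field_simp; ring
  have hw3 : K / R ^ 2 = K * R⁻¹ ^ 2 := by field_simp
  rw [hw1] at hcar
  rw [hw2, hw3] at hcac
  have iu := integrable_norm_sq u
  have hU : ∫ x in openRing d (3 / 4 * R) R, ‖u x‖ ^ 2 ≤
      ∫ x in {x : Rd d | R / 2 < ‖x‖}, ‖u x‖ ^ 2 := by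
    refine setIntegral_mono_set iu.integrableOn
      (Eventually.of_forall fun x => sq_nonneg _) (Eventually.of_forall ?_)
    exact fun x hx => lt_trans (by linarith) hx.1
  have hM : 0 ≤ ∫ x in {x : Rd d | R / 2 < ‖x‖}, ‖u x‖ ^ 2 := integral_nonneg fun x => sq_nonneg _
  set M := ∫ x in {x : Rd d | R / 2 < ‖x‖}, ‖u x‖ ^ 2
  set U := ∫ x in openRing d (3 / 4 * R) R, ‖u x‖ ^ 2
  set N := ∫ x in openRing d (3 / 4 * R) R, gradNormSq G x
  set ρ := R⁻¹ ^ 2 with hρ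
  have hρ0 : 0 ≤ ρ := sq_nonneg _
  have hN : 2 * N ≤ (17 * K * ρ + ρ + 2 * L) * M := by
    refine hcac.trans (mul_le_mul_of_nonneg_right ?_ hM)
    linarith
  rw [mul_assoc 9] at hcar
  refine hcar.trans ?_
  have hkey : (16 * K * ρ) ^ 2 * U + 3 * (16 * K * ρ) * N ≤
      (1072 * K ^ 2 + 96 * K) * (ρ ^ 2 + L * ρ) * M := by
    have h1 := mul_le_mul_of_nonneg_left hU (sq_nonneg (16 * K * ρ))
    have h2 := mul_le_mul_of_nonneg_left hN (by positivity : 0 ≤ 24 * K * ρ)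
    have h3 : 0 ≤ K ^ 2 * (ρ ^ 2) * M := by positivity
    have h4 : 0 ≤ K * (ρ ^ 2) * M := by positivity
    have h5 : 0 ≤ K ^ 2 * (L * ρ) * M := by positivity
    have h6 : 0 ≤ K * (L * ρ) * M := by positivity
    nlinarith
  have hρ2 : R⁻¹ ^ 4 = ρ ^ 2 := by rw [hρ]; ring
  rw [hρ2]
  calc _ ≤ Real.exp (9 * (τ * R ^ 2)) * ((1072 * K ^ 2 + 96 * K) * (ρ ^ 2 + L * ρ) * M) :=
        mul_le_mul_of_nonneg_left hkey (Real.exp_pos _).le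
    _ = _ := by ring

/-- The balls `|x| ≤ 3n/4` and the exteriors `|x| > n/2` cover the space, so the total mass is at
most `a n` plus a vanishing tail. -/
theorem eq_zero_of_tendsto_exterior {u : L2 d} {a : ℕ → ℝ} (ha : Tendsto a atTop (𝓝 0))
    (h : ∀ n : ℕ, 1 ≤ n → ∫ x in {x : Rd d | ‖x‖ ≤ 3 / 4 * (n : ℝ)}, ‖u x‖ ^ 2 ≤ a n) :
    u = 0 := by
  have iu := integrable_norm_sq u
  have hlim := ha.add (tendsto_setIntegral_lt_norm iu)
  have hle : ∫ x, ‖u x‖ ^ 2 ≤ 0 + 0 := by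
    refine ge_of_tendsto hlim ?_
    filter_upwards [eventually_ge_atTop 1] with n hn
    have hcompl : {x : Rd d | ‖x‖ ≤ 3 / 4 * (n : ℝ)}ᶜ ⊆ {x : Rd d | (n : ℝ) / 2 < ‖x‖} := by
      intro x hx
      have h1 : 3 / 4 * (n : ℝ) < ‖x‖ := not_le.1 hx
      have h2 : (0 : ℝ) ≤ n := n.cast_nonneg
      exact lt_of_le_of_lt (by linarith) h1
    rw [← integral_add_compl (measurableSet_norm_le (3 / 4 * (n : ℝ))) iu]
    refine add_le_add (h n hn) (setIntegral_mono_set iu.integrableOn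
      (Eventually.of_forall fun x => sq_nonneg _) (Eventually.of_forall hcompl))
  have hz : ∫ x, ‖u x‖ ^ 2 = 0 :=
    le_antisymm (by simpa using hle) (integral_nonneg fun x => sq_nonneg _)
  rw [integral_eq_zero_iff_of_nonneg (fun x => sq_nonneg _) iu] at hz
  rw [Lp.eq_zero_iff_ae_eq_zero]
  filter_upwards [hz] with x hx
  simpa using hx

theorem half_rpow_four_thirds_ge {R t : ℝ} (hR : 0 ≤ R) (h : R / 2 < t) :
    R ^ (4 / 3 : ℝ) ≤ 4 * t ^ (4 / 3 : ℝ) := by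
  have h1 : R ^ (4 / 3 : ℝ) ≤ (2 * t) ^ (4 / 3 : ℝ) :=
    Real.rpow_le_rpow hR (by linarith) (by norm_num)
  have h2 : (2 : ℝ) ^ (4 / 3 : ℝ) ≤ 4 := by
    calc (2 : ℝ) ^ (4 / 3 : ℝ) ≤ 2 ^ (2 : ℝ) :=
          Real.rpow_le_rpow_of_exponent_le (by norm_num) (by norm_num)
      _ = 4 := by norm_num
  rw [Real.mul_rpow (by norm_num) (by linarith)] at h1
  exact h1.trans (mul_le_mul_of_nonneg_right h2 (Real.rpow_nonneg (by linarith) _))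

/-- Solutions which decay faster than `exp (-C L^{2/3} |x|^{4/3})` vanish identically. -/
theorem eq_zero_of_integrable_weight (hd : 1 ≤ d) {L : ℝ} (hL : 0 ≤ L) {V : Rd d → ℂ} {u : L2 d}
    (hu : MemH2 u) (hsol : SolvesElliptic V u) (hV : PotentialBound V L)
    (hint : Integrable fun x : Rd d =>
      Real.exp (2 * (18 * L ^ (2 / 3 : ℝ)) * ‖x‖ ^ (4 / 3 : ℝ)) * ‖u x‖ ^ 2) :
    u = 0 := by
  obtain ⟨C, hC, hball⟩ := exists_ball_le_exterior hd
  have iu := integrable_norm_sq u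
  have htail := tendsto_setIntegral_lt_norm hint
  -- For `|x| > n/2`, `n^{4/3} ≤ 4|x|^{4/3}`, so the Carleman loss has exponent at most `36
  -- L^{2/3}|x|^{4/3}`; hence `η₀ = 18`.
  have hexpM : ∀ n : ℕ, Real.exp (9 * (L ^ (2 / 3 : ℝ) * (n : ℝ) ^ (4 / 3 : ℝ))) *
      ∫ x in {x : Rd d | (n : ℝ) / 2 < ‖x‖}, ‖u x‖ ^ 2 ≤
      ∫ x in {x : Rd d | (n : ℝ) / 2 < ‖x‖},
        Real.exp (2 * (18 * L ^ (2 / 3 : ℝ)) * ‖x‖ ^ (4 / 3 : ℝ)) * ‖u x‖ ^ 2 := by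
    intro n
    rw [← integral_const_mul]
    refine setIntegral_mono_on (iu.const_mul _).integrableOn hint.integrableOn
      (measurableSet_lt_norm _) fun x hx => ?_
    refine mul_le_mul_of_nonneg_right (Real.exp_le_exp.2 ?_) (sq_nonneg _)
    have h1 := half_rpow_four_thirds_ge n.cast_nonneg hx
    have h2 := mul_le_mul_of_nonneg_left h1 (Real.rpow_nonneg hL (2 / 3))
    linarith
  rcases hL.eq_or_lt with rfl | hLpos
  · have hlim := htail.const_mul (C * Real.exp 9)
    rw [mul_zero] at hlim
    refine eq_zero_of_tendsto_exterior hlim fun n hn => ?_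
    have hn0 : (0 : ℝ) < n := by exact_mod_cast hn
    -- For `L = 0` the scale `τ³n² = L²` would give `τ = 0` and an empty estimate. With `τ = n⁻²`
    -- the loss is the constant `e⁹`, and the factor `n⁻⁴` on both sides cancels.
    have h1 := hball 0 le_rfl V u hu hsol hV n ((n : ℝ)⁻¹ ^ 2) hn0 (by positivity)
      (by rw [zero_pow two_ne_zero]; positivity)
    have h2 := hexpM n
    have e1 : ((n : ℝ)⁻¹ ^ 2) ^ 3 * (n : ℝ) ^ 2 = (n : ℝ)⁻¹ ^ 4 := by field_simp
    have e2 : (n : ℝ)⁻¹ ^ 2 * (n : ℝ) ^ 2 = 1 := by field_simp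
    rw [e1, e2] at h1
    rw [Real.zero_rpow (by norm_num), zero_mul, mul_zero, Real.exp_zero, one_mul] at h2
    have hpos : 0 < (n : ℝ)⁻¹ ^ 4 := by positivity
    refine le_of_mul_le_mul_left (h1.trans ?_) hpos
    have h3 := mul_le_mul_of_nonneg_left h2 (by positivity : 0 ≤ (n : ℝ)⁻¹ ^ 4 * (C * Real.exp 9))
    rw [mul_one, zero_mul, add_zero]
    linarith
  · have hlim := htail.const_mul ((L ^ 2)⁻¹ * (C * (1 + L)))
    rw [mul_zero] at hlim
    refine eq_zero_of_tendsto_exterior hlim fun n hn => ?_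
    have hn1 : (1 : ℝ) ≤ n := by exact_mod_cast hn
    have hn0 : (0 : ℝ) < n := by linarith
    obtain ⟨τ, hτ, hτ3, hτ1⟩ := exists_scale hL hn0
    have h1 := hball L hL V u hu hsol hV n τ hn0 hτ hτ3.ge
    rw [hτ3, hτ1] at h1
    have hinv : (n : ℝ)⁻¹ ≤ 1 := inv_le_one_of_one_le₀ hn1
    have hinv0 : 0 ≤ (n : ℝ)⁻¹ := inv_nonneg.2 hn0.le
    have h2 : C * ((n : ℝ)⁻¹ ^ 4 + L * (n : ℝ)⁻¹ ^ 2) ≤ C * (1 + L) := by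
      refine mul_le_mul_of_nonneg_left (add_le_add (pow_le_one₀ hinv0 hinv) ?_) hC
      exact mul_le_of_le_one_right hL (pow_le_one₀ hinv0 hinv)
    rw [mul_assoc, ← div_eq_inv_mul, le_div_iff₀ (by positivity), mul_comm _ (L ^ 2)]
    refine h1.trans ((mul_le_mul_of_nonneg_right h2 ?_).trans
      (mul_le_mul_of_nonneg_left (hexpM n) (by positivity)))
    exact mul_nonneg (Real.exp_pos _).le (integral_nonneg fun x => sq_nonneg _)

end UniqueContinuation

theorem theorem3p1 (d : ℕ) (hd : 1 ≤ d) :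
    (∀ L A : ℝ, ∃ c : ℝ, 0 < c ∧
      ∀ (V : Rd d → ℂ) (u : L2 d) (G : Fin d → L2 d),
        MemH2 u → IsWeakGradient u G → SolvesElliptic V u → PotentialBound V L →
        1 ≤ (∫ x in {x : Rd d | ‖x‖ < 1}, ‖u x‖ ^ 2) →
        (∫ x, energyDensity u G x) ≤ A ^ 2 →
        ∀ R : ℝ, 1 ≤ R → c * Real.exp (-c * R ^ (4 / 3 : ℝ)) ≤ ringNorm u G R) ∧
    (∃ η₀ : ℝ, 0 < η₀ ∧
      ∀ L : ℝ, 0 ≤ L → ∀ (V : Rd d → ℂ) (u : L2 d),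
        MemH2 u → SolvesElliptic V u → PotentialBound V L →
        Integrable (fun x : Rd d =>
          Real.exp (2 * (η₀ * L ^ (2 / 3 : ℝ)) * ‖x‖ ^ (4 / 3 : ℝ)) * ‖u x‖ ^ 2) volume →
        u = 0) := by
  refine ⟨fun L A => ?_, 18, by norm_num, fun L hL V u hu hsol hV hint =>
    eq_zero_of_integrable_weight hd hL hu hsol hV hint⟩
  obtain ⟨c, hc, h⟩ := exists_ringNorm_lower_bound hd L
  exact ⟨c, hc, fun V u G hu hG hsol hV h1 _ => h V u G hu hG hsol hV h1⟩
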